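/- Graphs are finite and simple, and $e(G)$ denotes the number of edges of $G$. Write $K_m$ for the complete graph on $m$ vertices, $\cup$ for the vertex-disjoint union of graphs, and $\vee$ for the join (the disjoint union together with all edges between the two parts). A block of a graph is a maximal subgraph that is connected and contains no cut-vertex of its own. Graphs "contain $k$ cycles of consecutive even lengths" if for some integer $m$ they contain cycles of each of the lengths $2m,2m+2,\dots,2m+2(k-1)$. Theorem 1.7. Let $k$ and $n$ be integers with $2k+2\le n\le 4k+1$, and let $G$ be a graph of order $n$. (a) If $e(G)\ge\binom{2k+1}{2}+\binom{n-2k}{2}$, then $G$ contains cycles of every even length $4,6,\dots,2k+2$, unless $G\cong K_1\vee(K_{2k}\cup K_{n-2k-1})$. (b) This strengthens, and so proves, Verstraëte's conjecture in this range of $n$: one has $\binom{2k+1}{2}+\binom{n-2k}{2}\le\frac{(2k+1)(n-1)}{2}$, and if $G$ does not contain $k$ cycles of consecutive even lengths, then $e(G)\le\frac{(2k+1)(n-1)}{2}$, with equality only if every block of $G$ is a clique of order $2k+1$. -/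

import Mathlib

namespace SimpleGraph

universe u v

/-- The join `G ∨ H`: the disjoint union of `G` and `H` together with all edges between a vertex
of `G` and a vertex of `H`. -/
def graphJoin {V : Type u} {W : Type v} (G : SimpleGraph V) (H : SimpleGraph W) :
    SimpleGraph (V ⊕ W) :=
  (G ⊕g H) ⊔ completeBipartiteGraph V W

/-- `G` contains a cycle of length `l`. -/
def HasCycleOfLength {V : Type u} (G : SimpleGraph V) (l : ℕ) : Prop :=
  ∃ (v : V) (p : G.Walk v v), p.IsCycle ∧ p.length = l

/-- `G` contains `k` cycles of consecutive even lengths `2m, 2m + 2, …, 2m + 2(k - 1)`. -/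
def HasConsecutiveEvenCycles {V : Type u} (G : SimpleGraph V) (k : ℕ) : Prop :=
  ∃ m : ℕ, ∀ i < k, G.HasCycleOfLength (2 * m + 2 * i)

/-- A cut-vertex: its deletion increases the number of connected components
(for graphs with finitely many vertices). -/
def IsCutVertex {V : Type u} (G : SimpleGraph V) (v : V) : Prop :=
  Nat.card G.ConnectedComponent < Nat.card (G.induce ({v}ᶜ : Set V)).ConnectedComponent

/-- A block of `G`: a maximal subgraph that is connected and has no cut-vertex of its own. -/
def IsBlock {V : Type u} (G : SimpleGraph V) (B : G.Subgraph) : Prop :=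
  Maximal (fun H : G.Subgraph => H.Connected ∧ ∀ v, ¬ H.coe.IsCutVertex v) B

end SimpleGraph

/-! Put a = 2k + 1 and b = n - a. Twice the threshold is f(a) = a(a - 1) + b(b + 1), twice the size
of a "bow": cliques of orders a and b + 1 sharing one vertex (`IsBow`). The core,
`exists_even_cycle_or_isBow`, is that for odd a at least f(a)/2 edges force a cycle of length a + 1
or a bow.

Induct on b. Deleting a vertex of degree at most b preserves the bound; if a bow remains, that
degree was exactly b and `IsBow.extend` puts the vertex back. So let all degrees be at least b + 1,
with no cycle of length a + 1. Woodall's bound, or Dirac's theorem when a ≤ b + 2, gives a cycle of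
length at least a. Length a cannot be the maximum, since the bound for a longest cycle of odd length
is strict. Hence a longest cycle has length m ≥ a + 2. By Bondy's argument consecutive vertices on
it have degree sum at most m within it, and the vertices off it carry few edges, so e(G) ≤ n²/4.
This contradicts the threshold if a - b ≥ 3. Otherwise G is Hamiltonian, and the degree sums leave
only a = b + 2, settled by the equality case of Bondy's argument.

The bounds for a longest cycle come from a detour: a path Q off the cycle whose ends x, y have many
neighbours on it, found by peeling off vertices of low degree. Rerouting through Q, possibly with
one chord, would lengthen the cycle, so many pairs of cycle vertices are non-adjacent.
`detour_count` weighs them against the edges off the cycle.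

A shorter even length c + 1 has a smaller threshold f(c) if n < 2c; if n ≥ 2c, then ⌊n²/4⌋ edges
suffice. For (b), f(a)/2 is at most the conjectured bound, with equality only for b = 2k, where both
cliques of the bow have order 2k + 1. -/

namespace SimpleGraph

/-! ### Paths and cycles as vertex lists; rerouting a cycle along chords -/

variable {V : Type*} {G : SimpleGraph V}

/-- `L` lists the vertices of a path of `G` from `x` to `y`. -/
structure IsPathList (G : SimpleGraph V) (L : List V) (x y : V) : Prop where
  nodup : L.Nodup
  chain : L.IsChain G.Adj
  head : L.head? = some x
  last : L.getLast? = some y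

/-- `G` has a cycle of length `l`, given by the list of its vertices. -/
def HasListCycle (G : SimpleGraph V) (l : ℕ) : Prop :=
  ∃ L x y, G.IsPathList L x y ∧ G.Adj y x ∧ L.length = l ∧ 3 ≤ l

namespace IsPathList

variable {L L₁ L₂ : List V} {x y x' y' : V}

theorem singleton (x : V) : G.IsPathList [x] x x :=
  ⟨by simp, by simp, rfl, rfl⟩

theorem ne_nil (h : G.IsPathList L x y) : L ≠ [] := by
  rintro rfl
  simpa using h.head

theorem length_pos (h : G.IsPathList L x y) : 0 < L.length :=
  List.length_pos_of_ne_nil h.ne_nil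

theorem reverse (h : G.IsPathList L x y) : G.IsPathList L.reverse y x :=
  ⟨List.nodup_reverse.2 h.nodup,
    List.isChain_reverse.2 (h.chain.imp fun _ _ hab => hab.symm),
    by rw [List.head?_reverse, h.last], by rw [List.getLast?_reverse, h.head]⟩

theorem append (h₁ : G.IsPathList L₁ x y) (h₂ : G.IsPathList L₂ x' y') (hadj : G.Adj y x')
    (hd : ∀ v ∈ L₁, v ∉ L₂) : G.IsPathList (L₁ ++ L₂) x y' := by
  refine ⟨List.nodup_append.2 ⟨h₁.nodup, h₂.nodup, ?_⟩, List.isChain_append.2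
    ⟨h₁.chain, h₂.chain, ?_⟩, ?_, ?_⟩
  · rintro a ha b hb rfl
    exact hd a ha hb
  · intro a ha b hb
    rw [h₁.last] at ha
    rw [h₂.head] at hb
    cases ha
    cases hb
    exact hadj
  · rw [List.head?_append, h₁.head]; rfl
  · rw [List.getLast?_append, h₂.last]; rfl

theorem head_mem (h : G.IsPathList L x y) : x ∈ L := List.mem_of_mem_head? h.head

theorem last_mem (h : G.IsPathList L x y) : y ∈ L := List.mem_of_mem_getLast? h.last

theorem hasListCycle (h : G.IsPathList L x y) (hadj : G.Adj y x) (h3 : 3 ≤ L.length) :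
    G.HasListCycle L.length := ⟨L, x, y, h, hadj, rfl, h3⟩

theorem exists_walk : ∀ {L : List V} {x y : V}, G.IsPathList L x y →
    ∃ p : G.Walk x y, p.support = L
  | [], _, _, h => absurd rfl h.ne_nil
  | [a], x, y, h => by
    have h1 := h.head
    have h2 := h.last
    simp at h1 h2
    subst h1 h2
    exact ⟨.nil, rfl⟩
  | a :: b :: L, x, y, h => by
    have h1 := h.head
    simp at h1
    subst h1
    have hc := h.chain
    rw [List.isChain_cons_cons] at hc
    have hl := h.last
    rw [List.getLast?_cons_cons] at hl
    obtain ⟨p, hp⟩ := exists_walk (L := b :: L) (x := b) (y := y)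
      ⟨(List.nodup_cons.1 h.nodup).2, hc.2, rfl, hl⟩
    exact ⟨.cons hc.1 p, by simp [hp]⟩

end IsPathList

theorem HasListCycle.hasCycleOfLength {l : ℕ} (h : G.HasListCycle l) : G.HasCycleOfLength l := by
  obtain ⟨L, x, y, hL, hadj, rfl, h3⟩ := h
  obtain ⟨p, hp⟩ := hL.exists_walk
  have hpath : p.IsPath := .mk' (hp ▸ hL.nodup)
  have hlen : p.length + 1 = L.length := by rw [← hp, Walk.length_support]
  refine ⟨y, .cons hadj p, (Walk.cons_isCycle_iff p hadj).2 ⟨hpath, fun he => ?_⟩, by simpa using hlen⟩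
  -- A closing edge already on the path would have to be its first edge, as `x` is not visited
  -- again, and would end at `y`; the path would then be a single edge, against `3 ≤ L.length`.
  have : p.length = 1 := by
    cases p with
    | nil => simp at he
    | @cons _ w _ h q =>
      rw [Walk.cons_isPath_iff] at hpath
      rw [Walk.edges_cons, List.mem_cons] at he
      rcases he with he | he
      · rw [Sym2.eq_iff] at he
        rcases he with ⟨h1, h2⟩ | ⟨h1, h2⟩
        · exact absurd h1 hadj.ne
        · subst h1
          rw [Walk.length_cons, (Walk.isPath_iff_nil.1 hpath.1).length_eq_zero]
      · exact absurd (Walk.snd_mem_support_of_mem_edges q he) hpath.2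
  omega

/-- `h 0, …, h (m - 1)` are the vertices of a cycle of `G`, in cyclic order. -/
structure IsCycleSeq (G : SimpleGraph V) (m : ℕ) (h : ℕ → V) : Prop where
  inj : ∀ i j, i < m → j < m → h i = h j → i = j
  adj : ∀ i, i + 1 < m → G.Adj (h i) (h (i + 1))
  close : G.Adj (h (m - 1)) (h 0)

/-- The list `h a, …, h b`. -/
def seg (h : ℕ → V) (a b : ℕ) : List V := (List.range' a (b + 1 - a)).map h

theorem mem_seg {h : ℕ → V} {a b : ℕ} {v : V} : v ∈ seg h a b ↔ ∃ i, a ≤ i ∧ i ≤ b ∧ h i = v := by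
  simp only [seg, List.mem_map, List.mem_range'_1]
  constructor
  · rintro ⟨i, hi, rfl⟩; exact ⟨i, by omega, by omega, rfl⟩
  · rintro ⟨i, h1, h2, rfl⟩; exact ⟨i, by omega, rfl⟩

@[simp] theorem length_seg (h : ℕ → V) (a b : ℕ) : (seg h a b).length = b + 1 - a := by simp [seg]

theorem seg_self (h : ℕ → V) (a : ℕ) : seg h a a = [h a] := by simp [seg]

namespace IsCycleSeq

variable {m : ℕ} {h : ℕ → V}

theorem isPathList_seg (H : G.IsCycleSeq m h) {a b : ℕ} (hab : a ≤ b) (hb : b < m) :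
    G.IsPathList (seg h a b) (h a) (h b) := by
  induction b, hab using Nat.le_induction with
  | base => rw [seg_self]; exact .singleton _
  | succ b hab ih =>
    have : seg h a (b + 1) = seg h a b ++ [h (b + 1)] := by
      rw [seg, seg, show b + 1 + 1 - a = (b + 1 - a) + 1 by omega, List.range'_concat,
        List.map_append]
      simp
      congr 1
      omega
    rw [this]
    refine (ih (by omega)).append (.singleton _) (H.adj _ hb) fun v hv => ?_
    obtain ⟨i, hi1, hi2, rfl⟩ := mem_seg.1 hv
    rw [List.mem_singleton]
    intro he
    have := H.inj _ _ (by omega) hb he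
    omega

theorem seg_disjoint (H : G.IsCycleSeq m h) {a b a' b' : ℕ} (hb : b < m) (hb' : b' < m)
    (hd : b < a' ∨ b' < a) : ∀ v ∈ seg h a b, v ∉ seg h a' b' := by
  intro v hv hv'
  obtain ⟨i, hi1, hi2, rfl⟩ := mem_seg.1 hv
  obtain ⟨j, hj1, hj2, hj⟩ := mem_seg.1 hv'
  have := H.inj _ _ (by omega) (by omega) hj
  omega

variable {Q : List V} {x y : V}

/-- Replace the arc between `h 0` and `h g` by a path outside the cycle. -/
theorem insert_path (H : G.IsCycleSeq m h) (hQ : G.IsPathList Q x y)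
    (hoff : ∀ i < m, h i ∉ Q) {g : ℕ} (hg : 0 < g) (hgm : g < m)
    (hx : G.Adj (h 0) x) (hy : G.Adj y (h g)) : G.HasListCycle (m - g + 1 + Q.length) := by
  have h1 := (H.isPathList_seg (le_refl 0) (by omega)).append hQ hx (by
    intro v hv
    obtain ⟨i, hi1, hi2, rfl⟩ := mem_seg.1 hv
    exact hoff i (by omega))
  have h2 := h1.append (H.isPathList_seg (a := g) (b := m - 1) (by omega) (by omega)) hy (by
    intro v hv hv'
    rcases List.mem_append.1 hv with hv | hv
    · exact H.seg_disjoint (by omega) (by omega) (Or.inl hg) v hv hv'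
    · obtain ⟨i, hi1, hi2, rfl⟩ := mem_seg.1 hv'
      exact hoff i (by omega) hv)
  have := hQ.length_pos
  have h3 := h2.hasListCycle H.close (by simp; omega)
  convert h3 using 1
  simp; omega

/-- Insert a path outside the cycle between `h 0` and `h g` and use the chord from `h i` to
`h j`, where `0 < i ≤ g < j`. -/
theorem insert_path_chord (H : G.IsCycleSeq m h) (hQ : G.IsPathList Q x y)
    (hoff : ∀ i < m, h i ∉ Q) {g i j : ℕ} (hi : 0 < i) (hig : i ≤ g) (hgj : g < j) (hj : j < m)
    (hx : G.Adj (h 0) x) (hy : G.Adj y (h g)) (hij : G.Adj (h i) (h j)) :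
    G.HasListCycle (1 + Q.length + (g + 1 - i) + (m - j)) := by
  have h1 := (H.isPathList_seg (le_refl 0) (by omega)).append hQ hx (by
    intro v hv
    obtain ⟨i, hi1, hi2, rfl⟩ := mem_seg.1 hv
    exact hoff i (by omega))
  have h2 := h1.append (H.isPathList_seg hig (by omega)).reverse hy (by
    intro v hv hv'
    rw [List.mem_reverse] at hv'
    rcases List.mem_append.1 hv with hv | hv
    · exact H.seg_disjoint (by omega) (by omega) (Or.inl hi) v hv hv'
    · obtain ⟨i, hi1, hi2, rfl⟩ := mem_seg.1 hv'
      exact hoff i (by omega) hv)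
  have h3 := h2.append (H.isPathList_seg (a := j) (b := m - 1) (by omega) (by omega)) hij (by
    intro v hv hv'
    rcases List.mem_append.1 hv with hv | hv
    · rcases List.mem_append.1 hv with hv | hv
      · exact H.seg_disjoint (by omega) (by omega) (Or.inl (by omega)) v hv hv'
      · obtain ⟨i, hi1, hi2, rfl⟩ := mem_seg.1 hv'
        exact hoff i (by omega) hv
    · exact H.seg_disjoint (by omega) (by omega) (Or.inl hgj) v (List.mem_reverse.1 hv) hv')
  have := hQ.length_pos
  have h4 := h3.hasListCycle H.close (by simp; omega)
  convert h4 using 1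
  simp; omega

/-- The cycle through crossing chords at the consecutive vertices `h 0` and `h 1`. -/
theorem cycle_of_crossing (H : G.IsCycleSeq m h) {k j : ℕ} (hk : 1 ≤ k) (hkj : k < j) (hj : j < m)
    (h0 : G.Adj (h 0) (h k)) (h1 : G.Adj (h 1) (h j)) :
    G.HasListCycle (k + 1 + (m - j)) := by
  have e1 := (H.isPathList_seg hk (by omega)).append
    (H.isPathList_seg (le_refl 0) (by omega)) h0.symm
    (H.seg_disjoint (by omega) (by omega) (Or.inr (by omega)))
  have e2 := e1.append (H.isPathList_seg (a := j) (b := m - 1) (by omega) (by omega)).reverse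
    H.close.symm (by
      intro v hv hv'
      rw [List.mem_reverse] at hv'
      rcases List.mem_append.1 hv with hv | hv
      · exact H.seg_disjoint (by omega) (by omega) (Or.inl (by omega)) v hv hv'
      · exact H.seg_disjoint (by omega) (by omega) (Or.inl (by omega)) v hv hv')
  have e3 := e2.hasListCycle h1.symm (by simp; omega)
  convert e3 using 1
  simp; omega

/-- The cycle through parallel chords at the consecutive vertices `h 0` and `h 1`. -/
theorem cycle_of_parallel (H : G.IsCycleSeq m h) {k j : ℕ} (hj : 2 ≤ j) (hjk : j ≤ k) (hk : k < m)
    (h0 : G.Adj (h 0) (h k)) (h1 : G.Adj (h 1) (h j)) :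
    G.HasListCycle (2 + (k + 1 - j)) := by
  have e1 := (H.isPathList_seg (a := 0) (b := 1) (by omega) (by omega)).append
    (H.isPathList_seg hjk hk) h1
    (H.seg_disjoint (by omega) (by omega) (Or.inl (by omega)))
  have e3 := e1.hasListCycle h0.symm (by simp; omega)
  convert e3 using 1
  simp

end IsCycleSeq

/-! ### Cycles indexed by `ZMod m` -/

/-- The injective map `p` runs around a cycle of `G` of length `m`. -/
structure IsCycleMap (G : SimpleGraph V) {m : ℕ} (p : ZMod m → V) : Prop where
  inj : Function.Injective p
  adj : ∀ i, G.Adj (p i) (p (i + 1))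

theorem HasListCycle.exists_isCycleMap {m : ℕ} (h : G.HasListCycle m) :
    ∃ p : ZMod m → V, G.IsCycleMap p := by
  obtain ⟨L, x, y, hL, hadj, rfl, h3⟩ := h
  have : NeZero L.length := ⟨by omega⟩
  refine ⟨fun i => L[i.val]'(ZMod.val_lt i), fun i j hij => ?_, fun i => ?_⟩
  · exact ZMod.val_injective _ ((hL.nodup.getElem_inj_iff).1 hij)
  · by_cases hi : i.val + 1 < L.length
    · have h1 : (i + 1).val = i.val + 1 := by
        have : (1 : ZMod L.length).val = 1 := ZMod.val_one'' (by omega)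
        rw [ZMod.val_add_of_lt (by omega), this]
      simp only [h1]
      exact List.isChain_iff_getElem.1 hL.chain _ hi
    · have hlt := ZMod.val_lt i
      have h0 : i + 1 = 0 := by
        rw [← ZMod.natCast_zmod_val i, ← Nat.cast_one, ← Nat.cast_add,
          show i.val + 1 = L.length by omega]
        simp
      have hh := hL.head
      have hl := hL.last
      rw [List.head?_eq_getElem?, List.getElem?_eq_getElem (by omega)] at hh
      rw [List.getLast?_eq_getElem?, List.getElem?_eq_getElem (by omega)] at hl
      simp only [Option.some.injEq] at hh hl
      simp only [h0, ZMod.val_zero, show i.val = L.length - 1 by omega, hh, hl]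
      exact hadj

namespace IsCycleMap

variable {m : ℕ} {p : ZMod m → V}

/-- Rotation lets every rerouting argument start at position 0. -/
theorem isCycleSeq [NeZero m] (H : G.IsCycleMap p) (u : ZMod m) :
    G.IsCycleSeq m (fun k => p (u + k)) := by
  have hm : 0 < m := Nat.pos_of_ne_zero (NeZero.ne m)
  refine ⟨fun i j hi hj hij => ?_, fun i _ => ?_, ?_⟩
  · have := add_left_cancel (H.inj hij)
    rw [← ZMod.val_natCast_of_lt hi, this, ZMod.val_natCast_of_lt hj]
  · have := H.adj (u + i)
    simpa [add_assoc] using this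
  · have := H.adj (u + (m - 1 : ℕ))
    rw [add_assoc, ← Nat.cast_succ, show (m - 1).succ = m by omega] at this
    simpa using this

theorem neg (H : G.IsCycleMap p) : G.IsCycleMap (fun i => p (-i)) := by
  refine ⟨fun i j hij => neg_injective (H.inj hij), fun i => ?_⟩
  have := (H.adj (-(i + 1))).symm
  simpa using this

end IsCycleMap

end SimpleGraph

/-! ### Counting adjacent pairs and peeling -/

namespace SimpleGraph

open Finset
open scoped Classical in
/-- The neighbours of `v` in `S`. -/
noncomputable def nbrsIn {V : Type*} (G : SimpleGraph V) (v : V) (S : Finset V) : Finset V :=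
  {w ∈ S | G.Adj v w}

open scoped Classical in
/-- The ordered pairs of adjacent vertices in `S`. -/
noncomputable def adjPairs {V : Type*} (G : SimpleGraph V) (S : Finset V) : Finset (V × V) :=
  {e ∈ S ×ˢ S | G.Adj e.1 e.2}

section Counting

variable {V : Type*} {G : SimpleGraph V}

theorem mem_nbrsIn {v w : V} {S : Finset V} : w ∈ G.nbrsIn v S ↔ w ∈ S ∧ G.Adj v w := by
  simp [nbrsIn]

theorem card_adjPairs (S : Finset V) : #(G.adjPairs S) = ∑ v ∈ S, #(G.nbrsIn v S) := by
  classical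
  simp only [adjPairs, nbrsIn, card_filter, sum_product]

theorem card_adjPairs_univ [Fintype V] [DecidableRel G.Adj] :
    #(G.adjPairs univ) = 2 * #G.edgeFinset := by
  classical
  rw [card_adjPairs, ← sum_degrees_eq_twice_card_edges]
  refine sum_congr rfl fun v _ => ?_
  rw [← card_neighborFinset_eq_degree]
  congr 1
  ext w
  simp [mem_nbrsIn]

theorem card_nbrsIn_univ [Fintype V] [DecidableRel G.Adj] (v : V) :
    #(G.nbrsIn v univ) = G.degree v := by
  classical
  rw [← card_neighborFinset_eq_degree]
  congr 1
  ext w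
  simp [mem_nbrsIn]

theorem card_adjPairs_insert [DecidableEq V] {w : V} {S : Finset V} (hw : w ∉ S) :
    #(G.adjPairs (insert w S)) = #(G.adjPairs S) + 2 * #(G.nbrsIn w S) := by
  classical
  have h1 : ∀ v, #(G.nbrsIn v (insert w S)) = #(G.nbrsIn v S) + if G.Adj v w then 1 else 0 := by
    intro v
    unfold nbrsIn
    rw [filter_insert]
    split_ifs with h
    · rw [card_insert_of_notMem (by simp [hw])]
    · rfl
  rw [card_adjPairs, sum_insert hw, h1, card_adjPairs, sum_congr rfl fun v _ => h1 v,
    sum_add_distrib, ← card_filter]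
  simp only [G.irrefl, if_false]
  have : #{v ∈ S | G.Adj v w} = #(G.nbrsIn w S) := by
    unfold nbrsIn
    congr 1
    ext v
    simp [G.adj_comm]
  omega

theorem card_nbrsIn_union_le [DecidableEq V] (v : V) (S T : Finset V) :
    #(G.nbrsIn v (S ∪ T)) ≤ #(G.nbrsIn v S) + #(G.nbrsIn v T) := by
  classical
  unfold nbrsIn
  rw [filter_union]
  exact card_union_le _ _

/-- Remove the vertices of `R` one by one, each time one with at most `t` neighbours among those
still present. The factor 2 is there because pairs are ordered. -/
theorem card_adjPairs_union_le [DecidableEq V] {C : Finset V} {t : ℕ} (R : Finset V)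
    (hd : Disjoint C R)
    (h : ∀ S ⊆ R, S.Nonempty → ∃ w ∈ S, #(G.nbrsIn w (C ∪ S)) ≤ t) :
    #(G.adjPairs (C ∪ R)) ≤ #(G.adjPairs C) + 2 * #R * t := by
  induction hn : #R generalizing R with
  | zero => rw [card_eq_zero.1 hn]; simp
  | succ n ih =>
    obtain ⟨w, hw, hwt⟩ := h R subset_rfl (card_pos.1 (by omega))
    have hsub := erase_subset w R
    have := ih (R.erase w) (hd.mono_right hsub) (fun S hS => h S (hS.trans hsub))
      (by rw [card_erase_of_mem hw]; omega)
    have hC : w ∉ C := fun hc => Finset.disjoint_left.1 hd hc hw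
    have hins : insert w (C ∪ R.erase w) = C ∪ R := by
      rw [← union_insert, insert_erase hw]
    have hnm : w ∉ C ∪ R.erase w := by simp [hC]
    rw [← hins, card_adjPairs_insert hnm]
    have : #(G.nbrsIn w (C ∪ R.erase w)) ≤ #(G.nbrsIn w (C ∪ R)) := by
      apply card_le_card
      intro v hv
      rw [mem_nbrsIn] at hv ⊢
      exact ⟨union_subset_union_right hsub hv.1, hv.2⟩
    nlinarith

theorem exists_greatest_nat {P : ℕ → Prop} {N : ℕ} (hP : ∃ k, P k) (hN : ∀ k, P k → k ≤ N) :
    ∃ k, P k ∧ ∀ j, P j → j ≤ k := by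
  classical
  obtain ⟨k, hk⟩ := hP
  exact ⟨Nat.findGreatest P N, Nat.findGreatest_spec (hN k hk) hk,
    fun j hj => Nat.le_findGreatest (hN j hj) hj⟩

/-- A longest path inside `S` cannot be prolonged at either end. -/
theorem exists_longest_pathList {S : Finset V} (hS : S.Nonempty) :
    ∃ L x y, G.IsPathList L x y ∧ (∀ v ∈ L, v ∈ S) ∧ (∀ w ∈ S, G.Adj x w → w ∈ L) ∧
      (∀ w ∈ S, G.Adj y w → w ∈ L) := by
  classical
  obtain ⟨s, hs⟩ := hS
  obtain ⟨k, ⟨L, x, y, hL, hLS, rfl⟩, hmax⟩ := exists_greatest_nat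
    (P := fun k => ∃ L x y, G.IsPathList L x y ∧ (∀ v ∈ L, v ∈ S) ∧ L.length = k) (N := #S)
    ⟨1, [s], s, s, .singleton s, by simpa using hs, rfl⟩ (by
      rintro _ ⟨L, x, y, hL, hLS, rfl⟩
      rw [← List.toFinset_card_of_nodup hL.nodup]
      exact card_le_card fun v hv => hLS v (List.mem_toFinset.1 hv))
  refine ⟨L, x, y, hL, hLS, fun w hw hxw => ?_, fun w hw hyw => ?_⟩
  · by_contra hwL
    have h1 := (IsPathList.singleton (G := G) w).append hL hxw.symm (by simpa using hwL)
    have := hmax _ ⟨_, _, _, h1, by simpa [hw] using hLS, rfl⟩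
    simp at this
  · by_contra hwL
    have h1 := hL.append (IsPathList.singleton (G := G) w) hyw
      (fun v hv hvw => hwL (by rw [List.mem_singleton] at hvw; exact hvw ▸ hv))
    have := hmax _ ⟨_, _, _, h1, by
      intro v hv
      rcases List.mem_append.1 hv with hv | hv
      · exact hLS v hv
      · rw [List.mem_singleton] at hv; exact hv ▸ hw, rfl⟩
    simp at this

theorem IsPathList.card_nbrsIn_le {L : List V} {x y z : V} {S : Finset V} (hL : G.IsPathList L x y)
    (hz : z ∈ L) (h : ∀ w ∈ S, G.Adj z w → w ∈ L) : #(G.nbrsIn z S) + 1 ≤ L.length := by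
  classical
  rw [← List.toFinset_card_of_nodup hL.nodup, ← card_erase_add_one (List.mem_toFinset.2 hz)]
  gcongr
  intro w hw
  rw [mem_nbrsIn] at hw
  rw [mem_erase, List.mem_toFinset]
  exact ⟨hw.2.ne', h w hw.1 hw.2⟩

/-- A set `R` outside `C` contains a path both of whose ends have many neighbours in `C`, compared
with the number of edges that meet `R`. -/
theorem exists_path_of_peeling [Fintype V] [DecidableEq V] {C R : Finset V} {δ : ℕ}
    (hd : Disjoint C R)
    (hR : R.Nonempty) (hδ : ∀ w ∈ R, δ ≤ #(G.nbrsIn w (C ∪ R))) :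
    ∃ t L x y, δ ≤ t ∧ #(G.adjPairs (C ∪ R)) ≤ #(G.adjPairs C) + 2 * #R * t ∧
      G.IsPathList L x y ∧ (∀ v ∈ L, v ∈ R) ∧ L.length ≤ #R ∧
      t + 1 ≤ #(G.nbrsIn x C) + L.length ∧ t + 1 ≤ #(G.nbrsIn y C) + L.length := by
  classical
  -- `t` is the largest minimum degree into `C ∪ S` over nonempty `S ⊆ R`. Maximality makes `R`
  -- peelable with constant `t`, while the optimal `S` supplies the path.
  obtain ⟨t, ⟨S, hSR, hS, hSt⟩, hmax⟩ := exists_greatest_nat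
    (P := fun t => ∃ S ⊆ R, S.Nonempty ∧ ∀ w ∈ S, t ≤ #(G.nbrsIn w (C ∪ S)))
    (N := Fintype.card V) ⟨δ, R, subset_rfl, hR, hδ⟩ (by
      rintro t ⟨S, -, ⟨w, hw⟩, h⟩
      exact (h w hw).trans (card_le_univ _))
  obtain ⟨L, x, y, hL, hLS, hx, hy⟩ := exists_longest_pathList (G := G) hS
  -- An end of the path has at most `L.length - 1` neighbours in `S`, so the rest of its `t`
  -- neighbours lie in `C`.
  have key : ∀ z ∈ L, (∀ w ∈ S, G.Adj z w → w ∈ L) → t + 1 ≤ #(G.nbrsIn z C) + L.length := by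
    intro z hz h
    have h1 := hL.card_nbrsIn_le hz h
    have h2 := hSt z (hLS z hz)
    have h3 := card_nbrsIn_union_le (G := G) z C S
    omega
  refine ⟨t, L, x, y, hmax δ ⟨R, subset_rfl, hR, hδ⟩, card_adjPairs_union_le R hd ?_, hL,
    fun v hv => hSR (hLS v hv), ?_, key x hL.head_mem hx, key y hL.last_mem hy⟩
  · intro S' hS' hne
    by_contra! hcon
    have := hmax (t + 1) ⟨S', hS', hne, hcon⟩
    omega
  · rw [← List.toFinset_card_of_nodup hL.nodup]
    exact card_le_card fun v hv => hSR (hLS v (List.mem_toFinset.1 hv))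

end Counting

/-! ### Detours off a longest cycle -/

section Detour

variable {V : Type*} {G : SimpleGraph V} {m : ℕ} {p : ZMod m → V} {Q : List V} {x y : V}

/-- `p` runs around a longest cycle, and `Q` is a path from `x` to `y` off that cycle. -/
structure IsDetour (G : SimpleGraph V) {m : ℕ} (p : ZMod m → V) (Q : List V) (x y : V) :
    Prop where
  cycle : G.IsCycleMap p
  longest : ∀ l, G.HasListCycle l → l ≤ m
  path : G.IsPathList Q x y
  off : ∀ i, p i ∉ Q

theorem zmod_cast_inj {m i j : ℕ} (hi : i < m) (hj : j < m) (h : (i : ZMod m) = j) : i = j := by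
  rw [← ZMod.val_natCast_of_lt hi, h, ZMod.val_natCast_of_lt hj]

theorem zmod_exists_add [NeZero m] {u v : ZMod m} (h : u ≠ v) :
    ∃ g, 0 < g ∧ g < m ∧ v = u + (g : ℕ) := by
  refine ⟨(v - u).val, ?_, ZMod.val_lt _, by simp⟩
  rw [ZMod.val_pos, sub_ne_zero]
  exact h.symm

open scoped Classical in
/-- The positions on the cycle `p` of the neighbours of `x`. -/
noncomputable def attach [NeZero m] (G : SimpleGraph V) (p : ZMod m → V) (x : V) :
    Finset (ZMod m) := {i | G.Adj x (p i)}

theorem mem_attach [NeZero m] {i : ZMod m} : i ∈ G.attach p x ↔ G.Adj x (p i) := by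
  simp [attach]

theorem card_attach [NeZero m] [DecidableEq V] (hp : Function.Injective p) :
    #(G.attach p x) = #(G.nbrsIn x (univ.image p)) := by
  classical
  rw [← card_image_of_injective _ hp]
  congr 1
  ext v
  simp only [mem_image, mem_attach, mem_nbrsIn, mem_univ, true_and]
  constructor
  · rintro ⟨i, hi, rfl⟩; exact ⟨⟨i, rfl⟩, hi⟩
  · rintro ⟨⟨i, rfl⟩, hi⟩; exact ⟨i, hi, rfl⟩

namespace IsDetour

theorem symm (D : G.IsDetour p Q x y) : G.IsDetour p Q.reverse y x :=
  ⟨D.cycle, D.longest, D.path.reverse, by simpa using D.off⟩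

theorem neg (D : G.IsDetour p Q x y) : G.IsDetour (fun i => p (-i)) Q x y :=
  ⟨D.cycle.neg, D.longest, D.path, fun i => D.off (-i)⟩

theorem singleton (D : G.IsDetour p Q x y) : G.IsDetour p [x] x x :=
  ⟨D.cycle, D.longest, .singleton x, fun i hi => D.off i (by
    rw [List.mem_singleton.1 hi]; exact D.path.head_mem)⟩

variable [NeZero m]

/-- Replacing the `g - 1` inner vertices of the arc by `Q` must not lengthen the cycle. -/
theorem length_lt_of_attach (D : G.IsDetour p Q x y) {u : ZMod m} {g : ℕ} (hg : 0 < g) (hgm : g < m)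
    (hu : u ∈ G.attach p x) (hv : u + (g : ℕ) ∈ G.attach p y) : Q.length < g := by
  rw [mem_attach] at hu hv
  have := (D.cycle.isCycleSeq u).insert_path D.path (fun i _ => D.off _) hg hgm
    (by simpa using hu.symm) hv
  have := D.longest _ this
  omega

theorem length_add_lt_of_attach (D : G.IsDetour p Q x y) {u : ZMod m} {g : ℕ} (hg : 0 < g)
    (hgm : g < m)
    (hu : u ∈ G.attach p x) (hv : u + (g : ℕ) ∈ G.attach p y) : g + Q.length < m := by
  have := D.symm.length_lt_of_attach (u := u + (g : ℕ)) (g := m - g) (by omega) (by omega) hv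
    (by rw [add_assoc, ← Nat.cast_add, show g + (m - g) = m by omega]; simpa using hu)
  rw [List.length_reverse] at this
  omega

theorem length_lt (D : G.IsDetour p Q x y) {u v : ZMod m} (huv : u ≠ v)
    (hu : u ∈ G.attach p x) (hv : v ∈ G.attach p y) : 2 * Q.length + 2 ≤ m := by
  obtain ⟨g, hg, hgm, rfl⟩ := zmod_exists_add huv
  have h1 := D.length_lt_of_attach hg hgm hu hv
  have h2 := D.length_add_lt_of_attach hg hgm hu hv
  omega

/-- Such a chord together with `Q` gives a cycle that omits only `i + j - 2` cycle vertices and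
gains `Q.length`, hence is longer. -/
theorem not_adj (D : G.IsDetour p Q x y) {u v : ZMod m} (huv : u ≠ v)
    (hu : u ∈ G.attach p x) (hv : v ∈ G.attach p y) {i j : ℕ} (hi : 1 ≤ i) (hj : 1 ≤ j)
    (hij : i + j ≤ Q.length + 1) : ¬ G.Adj (p (u + i)) (p (v + j)) := by
  obtain ⟨g, hg, hgm, rfl⟩ := zmod_exists_add huv
  have h1 := D.length_lt_of_attach hg hgm hu hv
  have h2 := D.length_add_lt_of_attach hg hgm hu hv
  intro hadj
  rw [mem_attach] at hu hv
  have := (D.cycle.isCycleSeq u).insert_path_chord D.path (fun i _ => D.off _) (g := g) (i := i)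
    (j := g + j) hi (by omega) (by omega) (by omega) (by simpa using hu.symm) hv
    (by simpa [add_assoc] using hadj)
  have := D.longest _ this
  omega

/-- The mirror image of `not_adj` with `i = j = 1`, obtained by reversing the cycle. -/
theorem not_adj_sub_one (D : G.IsDetour p Q x y) {u v : ZMod m} (huv : u ≠ v)
    (hu : u ∈ G.attach p x) (hv : v ∈ G.attach p y) : ¬ G.Adj (p (u - 1)) (p (v - 1)) := by
  have := D.path.length_pos
  have := D.neg.not_adj (u := -u) (v := -v) (by simpa using huv)
    (by rw [mem_attach] at hu ⊢; simpa using hu) (by rw [mem_attach] at hv ⊢; simpa using hv)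
    (le_refl 1) (le_refl 1) (by omega)
  simpa [sub_eq_neg_add] using this

/-- Two positions attached to the same end are handled by the one-vertex detour at that end. -/
theorem not_adj_add_one (D : G.IsDetour p Q x y) {u v : ZMod m} (huv : u ≠ v)
    (hu : u ∈ G.attach p x ∪ G.attach p y) (hv : v ∈ G.attach p x ∪ G.attach p y) :
    ¬ G.Adj (p (u + 1)) (p (v + 1)) := by
  have := D.path.length_pos
  rw [mem_union] at hu hv
  have h1 : ((1 : ℕ) : ZMod m) = 1 := by simp
  rw [← h1]
  rcases hu with hu | hu <;> rcases hv with hv | hv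
  · exact D.singleton.not_adj huv hu hv le_rfl le_rfl (by simp)
  · exact D.not_adj huv hu hv le_rfl le_rfl (by omega)
  · exact D.symm.not_adj huv hu hv le_rfl le_rfl (by simp; omega)
  · exact D.symm.singleton.not_adj huv hu hv le_rfl le_rfl (by simp)

theorem add_one_notMem (D : G.IsDetour p Q x y) (hm : 1 < m) {u : ZMod m}
    (hu : u ∈ G.attach p x ∪ G.attach p y) : u + 1 ∉ G.attach p x ∪ G.attach p y := by
  intro hv
  have := D.path.length_pos
  rw [mem_union] at hu hv
  rw [← Nat.cast_one] at hv
  rcases hu with hu | hu <;> rcases hv with hv | hv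
  · have := D.singleton.length_lt_of_attach (g := 1) one_pos hm hu hv; simp at this
  · have := D.length_lt_of_attach (g := 1) one_pos hm hu hv; omega
  · have := D.symm.length_lt_of_attach (g := 1) one_pos hm hu hv
    rw [List.length_reverse] at this
    omega
  · have := D.symm.singleton.length_lt_of_attach (g := 1) one_pos hm hu hv; simp at this

/-- Between the last position attached to `x` before `a + g` and the next one attached to `y`
nothing is attached, and `length_lt_of_attach` says that this gap has at least `Q.length` inner
positions. -/
theorem exists_free_arc (D : G.IsDetour p Q x y) {a : ZMod m} {g : ℕ} (hg : 0 < g) (hgm : g < m)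
    (ha : a ∈ G.attach p x) (hb : a + (g : ℕ) ∈ G.attach p y) :
    ∃ k < g, a + (k : ℕ) ∈ G.attach p x ∧
      ∀ i : ℕ, 1 ≤ i → i ≤ Q.length → a + (k : ℕ) + (i : ℕ) ∉ G.attach p x ∪ G.attach p y := by
  classical
  obtain ⟨k, ⟨hkg, hk⟩, hkmax⟩ := exists_greatest_nat
    (P := fun k => k < g ∧ a + (k : ℕ) ∈ G.attach p x) (N := g) ⟨0, hg, by simpa using ha⟩
    (fun k hk => hk.1.le)
  have hex : ∃ l : ℕ, k < l ∧ a + (l : ℕ) ∈ G.attach p y := ⟨g, hkg, hb⟩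
  have hl := Nat.find_spec hex
  have hlmin := fun l => Nat.find_min hex (m := l)
  have hlg : Nat.find hex ≤ g := Nat.find_min' hex ⟨hkg, hb⟩
  set l := Nat.find hex
  have hlen := D.length_lt_of_attach (u := a + (k : ℕ)) (g := l - k) (by omega) (by omega) hk
    (by rw [add_assoc, ← Nat.cast_add, show k + (l - k) = l by omega]; exact hl.2)
  refine ⟨k, hkg, hk, fun i hi1 hi2 hmem => ?_⟩
  rw [add_assoc, ← Nat.cast_add, mem_union] at hmem
  rcases hmem with hmem | hmem
  · have := hkmax (k + i) ⟨by omega, hmem⟩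
    omega
  · exact hlmin (k + i) (by omega) ⟨by omega, hmem⟩

/-- One free arc is found on the way from `a` to `b`, the other on the way back with the roles of
`x` and `y` exchanged. -/
theorem exists_free_arcs (D : G.IsDetour p Q x y) {a b : ZMod m} (hab : a ≠ b)
    (ha : a ∈ G.attach p x) (hb : b ∈ G.attach p y) :
    ∃ u ∈ G.attach p x, ∃ v ∈ G.attach p y, u ≠ v ∧
      (∀ i : ℕ, 1 ≤ i → i ≤ Q.length → u + (i : ℕ) ∉ G.attach p x ∪ G.attach p y) ∧
      (∀ i : ℕ, 1 ≤ i → i ≤ Q.length → v + (i : ℕ) ∉ G.attach p x ∪ G.attach p y) := by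
  obtain ⟨g, hg, hgm, rfl⟩ := zmod_exists_add hab
  obtain ⟨k, hk, hka, hkf⟩ := D.exists_free_arc hg hgm ha hb
  obtain ⟨l, hl, hlb, hlf⟩ := D.symm.exists_free_arc (a := a + (g : ℕ)) (g := m - g) (by omega)
    (by omega) hb
    (by rw [add_assoc, ← Nat.cast_add, show g + (m - g) = m by omega]; simpa using ha)
  refine ⟨_, hka, _, hlb, fun h => ?_, hkf, fun i h1 h2 => ?_⟩
  · rw [add_assoc, add_right_inj, ← Nat.cast_add] at h
    have := zmod_cast_inj (by omega) (by omega) h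
    omega
  · rw [union_comm]
    exact hlf i h1 (by simpa using h2)

end IsDetour

end Detour

end SimpleGraph

/-! ### Non-adjacent pairs forced by a detour -/

namespace SimpleGraph

open Finset

variable {V : Type*} {G : SimpleGraph V} {m : ℕ} {p : ZMod m → V} {Q : List V} {x y : V}

/-- The positions `u + 2, …, u + q` on a cycle. -/
def tailArc (u : ZMod m) (q : ℕ) : Finset (ZMod m) :=
  (Icc 2 q).image fun i : ℕ => u + (i : ZMod m)

theorem mem_tailArc {u w : ZMod m} {q : ℕ} :
    w ∈ tailArc u q ↔ ∃ i : ℕ, 2 ≤ i ∧ i ≤ q ∧ u + (i : ZMod m) = w := by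
  simp [tailArc, and_assoc]

theorem card_tailArc {u : ZMod m} {q : ℕ} (hq : q < m) : #(tailArc u q) = q - 1 := by
  rw [tailArc, card_image_of_injOn, Nat.card_Icc]
  · omega
  · intro i hi j hj hij
    simp only [coe_Icc, Set.mem_Icc] at hi hj
    exact zmod_cast_inj (by omega) (by omega) (add_left_cancel hij)

theorem card_adjPairs_image [NeZero m] [DecidableEq V] (hp : Function.Injective p)
    {T : Finset (ZMod m × ZMod m)} (hT : ∀ e ∈ T, e.1 ≠ e.2 ∧ ¬ G.Adj (p e.1) (p e.2)) :
    #(G.adjPairs (univ.image p)) + #T ≤ m * (m - 1) := by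
  classical
  have h1 : G.adjPairs (univ.image p) =
      ({e : ZMod m × ZMod m | G.Adj (p e.1) (p e.2)} : Finset _).image (Prod.map p p) := by
    ext ⟨a, b⟩
    simp only [adjPairs, mem_filter, mem_product, mem_image, mem_univ, true_and, Prod.exists,
      Prod.map_apply, Prod.mk.injEq]
    constructor
    · rintro ⟨⟨⟨i, rfl⟩, ⟨j, rfl⟩⟩, h⟩
      exact ⟨i, j, h, rfl, rfl⟩
    · rintro ⟨i, j, h, rfl, rfl⟩
      exact ⟨⟨⟨i, rfl⟩, ⟨j, rfl⟩⟩, h⟩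
  rw [h1, card_image_of_injective _ (hp.prodMap hp), ← card_union_of_disjoint]
  · calc _ ≤ #(univ : Finset (ZMod m)).offDiag := by
          apply card_le_card
          intro e he
          rw [mem_offDiag]
          refine ⟨mem_univ _, mem_univ _, ?_⟩
          rcases mem_union.1 he with he | he
          · intro h
            have := (mem_filter.1 he).2
            rw [h] at this
            exact G.irrefl this
          · exact (hT e he).1
      _ = m * (m - 1) := by rw [offDiag_card, card_univ, ZMod.card, Nat.mul_sub, mul_one]
  · rw [Finset.disjoint_left]
    intro e he he'
    exact (hT e he').2 (mem_filter.1 he).2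

namespace IsDetour

variable [NeZero m]

section Arcs

variable {u v : ZMod m} (D : G.IsDetour p Q x y) (huv : u ≠ v)
  (hu : u ∈ G.attach p x) (hv : v ∈ G.attach p y)
  (hfu : ∀ i : ℕ, 1 ≤ i → i ≤ Q.length → u + (i : ℕ) ∉ G.attach p x ∪ G.attach p y)
  (hfv : ∀ i : ℕ, 1 ≤ i → i ≤ Q.length → v + (i : ℕ) ∉ G.attach p x ∪ G.attach p y)

theorem disjoint_tailArc
    (hfu : ∀ i : ℕ, 1 ≤ i → i ≤ Q.length → u + (i : ℕ) ∉ G.attach p x ∪ G.attach p y) :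
    Disjoint (G.attach p x ∪ G.attach p y) (tailArc u Q.length) := by
  rw [Finset.disjoint_right]
  intro w hw
  obtain ⟨i, h1, h2, rfl⟩ := mem_tailArc.1 hw
  exact hfu i (by omega) h2

theorem disjoint_succ_tailArc
    (hfu : ∀ i : ℕ, 1 ≤ i → i ≤ Q.length → u + (i : ℕ) ∉ G.attach p x ∪ G.attach p y) :
    Disjoint ((G.attach p x ∪ G.attach p y).image (· + 1)) (tailArc u Q.length) := by
  rw [Finset.disjoint_right]
  intro w hw hw'
  obtain ⟨i, h1, h2, rfl⟩ := mem_tailArc.1 hw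
  obtain ⟨z, hz, hzi⟩ := mem_image.1 hw'
  refine hfu (i - 1) (by omega) (by omega) ?_
  convert hz using 1
  rw [Nat.cast_sub (by omega), Nat.cast_one, ← add_sub_assoc, ← hzi]
  simp

-- If the arcs met, the start of one would lie inside the other, although it is an attached
-- position.
include huv hu hv hfu hfv in
theorem disjoint_tailArc_tailArc : Disjoint (tailArc u Q.length) (tailArc v Q.length) := by
  rw [Finset.disjoint_left]
  intro w hw hw'
  obtain ⟨i, h1, h2, rfl⟩ := mem_tailArc.1 hw
  obtain ⟨j, h3, h4, hij⟩ := mem_tailArc.1 hw'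
  rcases lt_trichotomy i j with h | h | h
  · refine hfv (j - i) (by omega) (by omega) (mem_union_left _ ?_)
    convert hu using 1
    rw [Nat.cast_sub h.le, ← add_sub_assoc, hij, add_sub_cancel_right]
  · subst h
    exact huv (add_right_cancel hij).symm
  · refine hfu (i - j) (by omega) (by omega) (mem_union_right _ ?_)
    convert hv using 1
    rw [Nat.cast_sub h.le, ← add_sub_assoc, ← hij, add_sub_cancel_right]

-- The attached positions, their successors and the two tail arcs are four disjoint sets of
-- positions.
include D huv hu hv hfu hfv in
theorem two_mul_card_add_le :
    2 * #(G.attach p x ∪ G.attach p y) + 2 * (Q.length - 1) ≤ m := by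
  have hm := D.length_lt huv hu hv
  have hI : #((G.attach p x ∪ G.attach p y).image (· + 1)) = #(G.attach p x ∪ G.attach p y) :=
    card_image_of_injective _ (add_left_injective 1)
  have d1 : Disjoint (G.attach p x ∪ G.attach p y)
      ((G.attach p x ∪ G.attach p y).image (· + 1)) := by
    rw [Finset.disjoint_right]
    intro w hw
    obtain ⟨z, hz, rfl⟩ := mem_image.1 hw
    exact D.add_one_notMem (by omega) hz
  have d2 := disjoint_union_left.2 ⟨disjoint_tailArc hfu, disjoint_succ_tailArc hfu⟩
  have d3 := disjoint_union_left.2 ⟨disjoint_union_left.2 ⟨disjoint_tailArc hfv,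
    disjoint_succ_tailArc hfv⟩, disjoint_tailArc_tailArc huv hu hv hfu hfv⟩
  have := card_le_univ (((G.attach p x ∪ G.attach p y) ∪
    ((G.attach p x ∪ G.attach p y).image (· + 1)) ∪ tailArc u Q.length) ∪ tailArc v Q.length)
  rw [card_union_of_disjoint d3, card_union_of_disjoint d2, card_union_of_disjoint d1, hI,
    card_tailArc (by omega), card_tailArc (by omega), ZMod.card] at this
  omega

include D huv hu hv hfu hfv in
/-- Non-adjacent pairs of positions forced by a detour off a longest cycle. -/
theorem exists_nonadjacent_pairs :
    ∃ T : Finset (ZMod m × ZMod m), (∀ e ∈ T, e.1 ≠ e.2 ∧ ¬ G.Adj (p e.1) (p e.2)) ∧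
      #(G.attach p x ∪ G.attach p y) * (#(G.attach p x ∪ G.attach p y) - 1) +
        2 * (Q.length - 1) * (#(G.attach p x) - 1 + (#(G.attach p y) - 1)) +
        (Q.length - 1) * (Q.length - 1 - 1) ≤ #T ∧
      (∀ e ∈ T, (e.1 ∈ (G.attach p x ∪ G.attach p y).image (· + 1) ∧
          (e.2 ∈ (G.attach p x ∪ G.attach p y).image (· + 1))) ∨
        (2 ≤ Q.length ∧ e ≠ (v + (Q.length : ℕ), u + (Q.length : ℕ)) ∧
          e.1 ∈ (G.attach p x ∪ G.attach p y).image (· + 1) ∪ tailArc u Q.length ∪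
            tailArc v Q.length ∧
          e.2 ∈ (G.attach p x ∪ G.attach p y).image (· + 1) ∪ tailArc u Q.length ∪
            tailArc v Q.length)) := by
  have hm := D.length_lt huv hu hv
  set q := Q.length with hq
  set A := G.attach p x with hA
  set B := G.attach p y with hB
  set I := (A ∪ B).image (· + 1) with hI
  set U := tailArc u q with hU
  set W := tailArc v q with hW
  have hinj : Function.Injective (fun i : ZMod m => i + 1) := add_left_injective 1
  have cI : #I = #(A ∪ B) := card_image_of_injective _ hinj
  have dIU : Disjoint I U := disjoint_succ_tailArc hfu
  have dIW : Disjoint I W := disjoint_succ_tailArc hfv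
  have dUW : Disjoint U W := disjoint_tailArc_tailArc huv hu hv hfu hfv
  -- `not_adj` needs two distinct starting positions, so the successor of `u` is left out here and
  -- that of `v` below; hence the terms `#A - 1` and `#B - 1`.
  set IB := (B.image (· + 1)).erase (u + 1) with hIB
  set IA := (A.image (· + 1)).erase (v + 1) with hIA
  have hIBI : ∀ w ∈ IB, w ∈ I := fun w hw =>
    image_subset_image subset_union_right (mem_of_mem_erase hw)
  have hIAI : ∀ w ∈ IA, w ∈ I := fun w hw =>
    image_subset_image subset_union_left (mem_of_mem_erase hw)
  have cIB : #B - 1 ≤ #IB := by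
    have := pred_card_le_card_erase (s := B.image (· + 1)) (a := u + 1)
    rwa [card_image_of_injective _ hinj] at this
  have cIA : #A - 1 ≤ #IA := by
    have := pred_card_le_card_erase (s := A.image (· + 1)) (a := v + 1)
    rwa [card_image_of_injective _ hinj] at this
  -- The pairs `(u + i, v + j)` with `i, j ≥ 2` and `i + j ≤ q + 1`; there are `(q - 1)(q - 2)/2` of
  -- them.
  set Z : Finset (ZMod m × ZMod m) := ((range (q - 1)).sigma fun a => range a).image
    (fun s => (u + ((q - s.1 : ℕ) : ZMod m), v + ((s.2 + 2 : ℕ) : ZMod m))) with hZ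
  have mZ : ∀ e ∈ Z, ∃ i j : ℕ, 2 ≤ i ∧ 2 ≤ j ∧ i + j ≤ q + 1 ∧
      e = (u + (i : ZMod m), v + (j : ZMod m)) := by
    intro e he
    obtain ⟨⟨a, b⟩, hs, rfl⟩ := mem_image.1 he
    rw [mem_sigma, mem_range, mem_range] at hs
    dsimp only at hs
    exact ⟨_, _, by dsimp only; omega, by dsimp only; omega, by dsimp only; omega, rfl⟩
  have cZ : 2 * #Z = (q - 1) * (q - 1 - 1) := by
    rw [hZ, card_image_of_injOn, card_sigma]
    · simp only [card_range]
      rw [mul_comm, sum_range_id_mul_two]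
    · rintro ⟨a, b⟩ hs ⟨a', b'⟩ hs' h
      simp only [coe_sigma, Set.mem_sigma_iff, mem_coe, mem_range] at hs hs'
      simp only [Prod.mk.injEq, add_right_inj] at h
      have h1 := zmod_cast_inj (by omega) (by omega) h.1
      have h2 := zmod_cast_inj (by omega) (by omega) h.2
      have ha : a = a' := by omega
      have hb : b = b' := by omega
      subst ha hb
      rfl
  have Z1 : ∀ e ∈ Z, e.1 ∈ U ∧ e.2 ∈ W := by
    intro e he
    obtain ⟨i, j, h1, h2, h3, rfl⟩ := mZ e he
    exact ⟨mem_tailArc.2 ⟨i, h1, by omega, rfl⟩, mem_tailArc.2 ⟨j, h2, by omega, rfl⟩⟩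
  set X := U ×ˢ IB ∪ W ×ˢ IA ∪ Z with hX
  have mX : ∀ e ∈ X, (e.1 ∈ U ∧ e.2 ∈ IB) ∨ (e.1 ∈ W ∧ e.2 ∈ IA) ∨ e ∈ Z := by
    intro e he
    simpa only [hX, mem_union, mem_product, or_assoc] using he
  have nIU : ∀ w ∈ U, w ∉ I := fun w hw hw' => Finset.disjoint_left.1 dIU hw' hw
  have nIW : ∀ w ∈ W, w ∉ I := fun w hw hw' => Finset.disjoint_left.1 dIW hw' hw
  have nUW : ∀ w ∈ U, w ∉ W := fun w hw hw' => Finset.disjoint_left.1 dUW hw hw'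
  have cX : #X = (q - 1) * #IB + (q - 1) * #IA + #Z := by
    rw [hX, card_union_of_disjoint, card_union_of_disjoint, card_product, card_product,
      card_tailArc (by omega), card_tailArc (by omega)]
    · rw [Finset.disjoint_left]
      intro e he he'
      rw [mem_product] at he he'
      exact nUW _ he.1 he'.1
    · rw [Finset.disjoint_left]
      intro e he he'
      have := Z1 e he'
      rw [mem_union, mem_product, mem_product] at he
      rcases he with he | he
      · exact nIW _ this.2 (hIBI _ he.2)
      · exact nUW _ this.1 he.1
  have X1 : ∀ e ∈ X, e.1 ∉ I := by
    intro e he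
    rcases mX e he with h | h | h
    · exact nIU _ h.1
    · exact nIW _ h.1
    · exact nIU _ (Z1 e h).1
  have X2 : ∀ e ∈ X, e.swap ∉ X := by
    intro e he he'
    have h1 := X1 e he
    have h2 := X1 _ he'
    rcases mX e he with h | h | h
    · exact h2 (hIBI _ h.2)
    · exact h2 (hIAI _ h.2)
    · rcases mX _ he' with h' | h' | h'
      · exact h1 (hIBI _ h'.2)
      · exact h1 (hIAI _ h'.2)
      · exact nUW _ (Z1 _ h').1 (Z1 e h).2
  have X3 : ∀ e ∈ X, e.1 ≠ e.2 ∧ ¬ G.Adj (p e.1) (p e.2) := by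
    rintro ⟨a, b⟩ he
    rcases mX _ he with h | h | h
    · refine ⟨fun hab => nIU _ h.1 (hab ▸ hIBI _ h.2), ?_⟩
      obtain ⟨i, hi1, hi2, rfl⟩ := mem_tailArc.1 h.1
      obtain ⟨hne, hb⟩ := mem_erase.1 h.2
      obtain ⟨w, hw, rfl⟩ := mem_image.1 hb
      have := D.not_adj (u := u) (v := w) (fun h => hne (by simp [h])) hu hw (i := i) (j := 1)
        (by omega) le_rfl (by omega)
      simpa using this
    · refine ⟨fun hab => nIW _ h.1 (hab ▸ hIAI _ h.2), ?_⟩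
      obtain ⟨i, hi1, hi2, rfl⟩ := mem_tailArc.1 h.1
      obtain ⟨hne, hb⟩ := mem_erase.1 h.2
      obtain ⟨w, hw, rfl⟩ := mem_image.1 hb
      have := D.symm.not_adj (u := v) (v := w) (fun h => hne (by simp [h])) hv hw (i := i) (j := 1)
        (by omega) le_rfl (by rw [List.length_reverse]; omega)
      simpa using this
    · have h' := Z1 _ h
      refine ⟨fun hab => nUW _ h'.1 (hab ▸ h'.2), ?_⟩
      obtain ⟨i, j, h1, h2, h3, he⟩ := mZ _ h
      rw [Prod.mk.injEq] at he
      dsimp only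
      rw [he.1, he.2]
      exact D.not_adj huv hu hv (by omega) (by omega) h3
  have X4 : ∀ e ∈ X, 2 ≤ q := by
    intro e he
    rcases mX e he with h | h | h
    · obtain ⟨i, h1, h2, -⟩ := mem_tailArc.1 h.1; omega
    · obtain ⟨i, h1, h2, -⟩ := mem_tailArc.1 h.1; omega
    · obtain ⟨i, h1, h2, -⟩ := mem_tailArc.1 (Z1 e h).1; omega
  have hUq : 2 ≤ q → u + (q : ZMod m) ∈ U := fun h => mem_tailArc.2 ⟨q, h, le_rfl, rfl⟩
  have hWq : 2 ≤ q → v + (q : ZMod m) ∈ W := fun h => mem_tailArc.2 ⟨q, h, le_rfl, rfl⟩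
  -- The two arc ends are never paired, since `q + q > q + 1` for `q ≥ 2`. The equality case for odd
  -- cycles rests on this.
  have X5 : ∀ e ∈ X, e ≠ (u + (q : ZMod m), v + (q : ZMod m)) ∧
      e ≠ (v + (q : ZMod m), u + (q : ZMod m)) := by
    intro e he
    have h2q := X4 e he
    refine ⟨?_, ?_⟩ <;> rintro rfl
    · rcases mX _ he with h | h | h
      · exact nIW _ (hWq h2q) (hIBI _ h.2)
      · exact nUW _ (hUq h2q) h.1
      · obtain ⟨i, j, h1, h2, h3, he⟩ := mZ _ h
        simp only [Prod.mk.injEq, add_right_inj] at he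
        have := zmod_cast_inj (by omega) (by omega) he.1
        have := zmod_cast_inj (by omega) (by omega) he.2
        omega
    · rcases mX _ he with h | h | h
      · exact nUW _ h.1 (hWq h2q)
      · exact nIU _ (hUq h2q) (hIAI _ h.2)
      · exact nUW _ (Z1 _ h).1 (hWq h2q)
  have X6 : ∀ e ∈ X, e.1 ∈ I ∪ U ∪ W ∧ e.2 ∈ I ∪ U ∪ W := by
    intro e he
    simp only [mem_union]
    rcases mX e he with h | h | h
    · exact ⟨Or.inl (Or.inr h.1), Or.inl (Or.inl (hIBI _ h.2))⟩
    · exact ⟨Or.inr h.1, Or.inl (Or.inl (hIAI _ h.2))⟩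
    · exact ⟨Or.inl (Or.inr (Z1 e h).1), Or.inr (Z1 e h).2⟩
  refine ⟨I.offDiag ∪ X ∪ X.image Prod.swap, ?_, ?_, ?_⟩
  · intro e he
    rw [mem_union, mem_union, mem_offDiag] at he
    rcases he with (he | he) | he
    · refine ⟨he.2.2, ?_⟩
      obtain ⟨a, ha, ha'⟩ := mem_image.1 he.1
      obtain ⟨b, hb, hb'⟩ := mem_image.1 he.2.1
      rw [← ha', ← hb']
      refine D.not_adj_add_one (fun hab => he.2.2 ?_) ha hb
      rw [← ha', ← hb', hab]
    · exact X3 e he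
    · obtain ⟨e', he', rfl⟩ := mem_image.1 he
      exact ⟨(X3 e' he').1.symm, fun h => (X3 e' he').2 h.symm⟩
  · have cT : #(I.offDiag ∪ X ∪ X.image Prod.swap) = #I * (#I - 1) + 2 * #X := by
      rw [card_union_of_disjoint, card_union_of_disjoint, offDiag_card,
        card_image_of_injective _ Prod.swap_injective, Nat.mul_sub, mul_one]
      · omega
      · rw [Finset.disjoint_left]
        intro e he he'
        exact X1 e he' (mem_offDiag.1 he).1
      · rw [Finset.disjoint_left]
        intro e he he'
        obtain ⟨e', h', rfl⟩ := mem_image.1 he'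
        rcases mem_union.1 he with he | he
        · exact X1 e' h' (mem_offDiag.1 he).2.1
        · exact X2 e' h' he
    rw [cT, cI, cX]
    have h1 := Nat.mul_le_mul_left (q - 1) cIA
    have h2 := Nat.mul_le_mul_left (q - 1) cIB
    have h3 : 2 * (q - 1) * (#A - 1 + (#B - 1)) =
      2 * ((q - 1) * (#A - 1)) + 2 * ((q - 1) * (#B - 1)) := by ring
    omega
  · intro e he
    rw [mem_union, mem_union, mem_offDiag] at he
    rcases he with (he | he) | he
    · exact Or.inl ⟨he.1, he.2.1⟩
    · exact Or.inr ⟨X4 e he, (X5 e he).2, X6 e he⟩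
    · obtain ⟨e', he', rfl⟩ := mem_image.1 he
      exact Or.inr ⟨X4 e' he', fun h => (X5 e' he').1 (Prod.swap_injective h), (X6 e' he').symm⟩

end Arcs

end IsDetour

end SimpleGraph

/-! ### Edge bounds from a longest cycle; Dirac's theorem -/

namespace SimpleGraph

open Finset

variable {V : Type*} {G : SimpleGraph V} {m : ℕ} {p : ZMod m → V} {Q : List V} {x y : V}

theorem card_univ_image [NeZero m] [DecidableEq V] (hp : Function.Injective p) :
    #(univ.image p) = m := by
  rw [card_image_of_injective _ hp, card_univ, ZMod.card]

theorem IsCycleMap.exists_detour [NeZero m] [Fintype V] [DecidableEq V] [DecidableRel G.Adj]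
    (H : G.IsCycleMap p)
    (hlong : ∀ l, G.HasListCycle l → l ≤ m) (hm : m < Fintype.card V) {δ : ℕ}
    (hδ : ∀ v, δ ≤ G.degree v) (hmδ : Fintype.card V - m + 1 ≤ δ) :
    ∃ t Q x y, G.IsDetour p Q x y ∧ δ ≤ t ∧
      2 * #G.edgeFinset ≤ #(G.adjPairs (univ.image p)) + 2 * (Fintype.card V - m) * t ∧
      Q.length ≤ Fintype.card V - m ∧ t + 1 ≤ #(G.attach p x) + Q.length ∧
      t + 1 ≤ #(G.attach p y) + Q.length ∧ ∃ a ∈ G.attach p x, ∃ b ∈ G.attach p y, a ≠ b := by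
  set C := univ.image p with hC
  have hCR : C ∪ Cᶜ = univ := union_compl C
  have cC : #C = m := card_univ_image H.inj
  have cR : #Cᶜ = Fintype.card V - m := by rw [card_compl, cC]
  have hd : Disjoint C Cᶜ := disjoint_compl_right
  obtain ⟨t, L, x, y, hδt, he, hL, hLR, hLr, hx, hy⟩ := exists_path_of_peeling (G := G) hd
    (card_pos.1 (by omega)) (fun w _ => by rw [hCR, card_nbrsIn_univ]; exact hδ w)
  rw [hCR, card_adjPairs_univ, cR] at he
  rw [cR] at hLr
  rw [← card_attach H.inj] at hx hy
  obtain ⟨a, ha⟩ : (G.attach p x).Nonempty := card_pos.1 (by omega)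
  -- As `Q.length ≤ n - m < δ ≤ t`, each end of `Q` has at least two neighbours on the cycle.
  obtain ⟨b, hb, hab⟩ := exists_mem_ne (s := G.attach p y) (by omega) a
  exact ⟨t, L, x, y, ⟨H, hlong, hL, fun i hi => (mem_compl.1 (hLR _ hi))
    (mem_image_of_mem p (mem_univ i))⟩, hδt, he, hLr, hx, hy, a, ha, b, hb, hab.symm⟩

/-- Off a longest cycle of length `m` there are few edges, if the minimum degree is large. -/
theorem IsCycleMap.edges_le_of_longest [NeZero m] [Fintype V] [DecidableEq V] [DecidableRel G.Adj]
    (H : G.IsCycleMap p)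
    (hlong : ∀ l, G.HasListCycle l → l ≤ m) (hm : m < Fintype.card V) {δ : ℕ}
    (hδ : ∀ v, δ ≤ G.degree v) (hmδ : Fintype.card V - m + 1 ≤ δ) :
    2 * δ ≤ m ∧
      2 * #G.edgeFinset ≤ #(G.adjPairs (univ.image p)) + (Fintype.card V - m) * m := by
  obtain ⟨t, Q, x, y, D, hδt, he, hQ, hx, hy, a, ha, b, hb, hab⟩ :=
    H.exists_detour hlong hm hδ hmδ
  obtain ⟨u, hu, v, hv, huv, hfu, hfv⟩ := D.exists_free_arcs hab ha hb
  have h1 := D.two_mul_card_add_le huv hu hv hfu hfv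
  have h2 : #(G.attach p x) ≤ #(G.attach p x ∪ G.attach p y) := card_le_card subset_union_left
  have := D.path.length_pos
  have ht : 2 * t ≤ m := by omega
  refine ⟨by omega, he.trans ?_⟩
  have := Nat.mul_le_mul_left (Fintype.card V - m) ht
  nlinarith

/-- With `s = t - r - 1` one has `r(r + 1) + t² = 2rt + t + s(s + 1)`, so `t(t - 1) ≤ F` suffices.
At the smallest values `N = α = β = t + 1 - q` the given lower bound for `F` exceeds `t(t - 1)` by
exactly `2(q - 1)(t - q - 1)`. Equality makes this vanish, whence `q = 1` or `N = 2`. -/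
theorem detour_count {r t q N α β F : ℕ} (hq : 1 ≤ q) (hrt : r + 1 ≤ t) (hqr : q ≤ r)
    (hα : t + 1 ≤ α + q) (hβ : t + 1 ≤ β + q) (hN : α ≤ N)
    (hF : N * (N - 1) + 2 * (q - 1) * (α - 1 + (β - 1)) + (q - 1) * (q - 1 - 1) ≤ F) :
    2 * r * t ≤ F + r * (r + 1) ∧
      (2 * r * t = F + r * (r + 1) → N + q = t + 1 ∧ (q = 1 ∨ N = 2)) := by
  obtain ⟨q, rfl⟩ : ∃ q', q = q' + 1 := ⟨q - 1, by omega⟩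
  obtain ⟨d, rfl⟩ : ∃ d, t = d + 2 + q := ⟨t - q - 2, by omega⟩
  obtain ⟨a, rfl⟩ : ∃ a, α = d + 2 + a := ⟨α - (d + 2), by omega⟩
  obtain ⟨b, rfl⟩ : ∃ b, β = d + 2 + b := ⟨β - (d + 2), by omega⟩
  obtain ⟨c, rfl⟩ : ∃ c, N = d + 2 + c := ⟨N - (d + 2), by omega⟩
  obtain ⟨s, hs⟩ : ∃ s, d + 2 + q = r + 1 + s := ⟨d + 2 + q - (r + 1), by omega⟩
  have e1 : d + 2 + c - 1 = d + 1 + c := by omega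
  have e2 : d + 2 + a - 1 + (d + 2 + b - 1) = 2 * d + 2 + a + b := by omega
  have e3 : q * (q - 1) + q = q * q := by cases q <;> simp; ring
  rw [Nat.add_sub_cancel, e1, e2] at hF
  have hs2 : r * (r + 1) + (d + 2 + q) * (d + 2 + q) =
      2 * r * (d + 2 + q) + (d + 2 + q) + s * (s + 1) := by
    rw [hs]; ring
  have key : (d + 2 + q) * (d + 2 + q) + 2 * (q * d) + c * (2 * d + 3 + c) ≤ F + (d + 2 + q) := by
    nlinarith [Nat.zero_le (q * a), Nat.zero_le (q * b)]
  refine ⟨by nlinarith [Nat.zero_le (s * (s + 1)), Nat.zero_le (q * d),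
    Nat.zero_le (c * (2 * d + 3 + c))], fun heq => ?_⟩
  have hz : 2 * (q * d) + c * (2 * d + 3 + c) ≤ 0 := by
    nlinarith [Nat.zero_le (s * (s + 1))]
  have h1 : q * d = 0 := by
    have := Nat.zero_le (c * (2 * d + 3 + c))
    omega
  have h2 : c * (2 * d + 3 + c) = 0 := by omega
  have hc : c = 0 := by
    rcases Nat.mul_eq_zero.1 h2 with h | h
    · exact h
    · omega
  refine ⟨by omega, ?_⟩
  rcases Nat.mul_eq_zero.1 h1 with h | h
  · left; omega
  · right; omega

/-- The number of edges of a graph with a longest cycle of length `m` and with minimum degree larger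
than the number of vertices off that cycle; the bound is strict for odd `m`. -/
theorem IsCycleMap.two_mul_card_edgeFinset_le [NeZero m] [Fintype V] [DecidableEq V]
    [DecidableRel G.Adj] (H : G.IsCycleMap p)
    (hlong : ∀ l, G.HasListCycle l → l ≤ m) {r : ℕ} (hr : 0 < r) (hn : Fintype.card V = m + r)
    (hδ : ∀ v, r + 1 ≤ G.degree v) :
    2 * #G.edgeFinset ≤ m * (m - 1) + r * (r + 1) ∧
      (Odd m → 2 * #G.edgeFinset < m * (m - 1) + r * (r + 1)) := by
  have hrn : Fintype.card V - m = r := by omega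
  obtain ⟨t, Q, x, y, D, hδt, he, hQ, hx, hy, a, ha, b, hb, hab⟩ :=
    H.exists_detour hlong (by omega) hδ (by omega)
  rw [hrn] at he hQ
  obtain ⟨u, hu, v, hv, huv, hfu, hfv⟩ := D.exists_free_arcs hab ha hb
  obtain ⟨T, hT, hTc, hTm⟩ := D.exists_nonadjacent_pairs huv hu hv hfu hfv
  have hm := D.length_lt huv hu hv
  have hqpos := D.path.length_pos
  have hcount := card_adjPairs_image (G := G) H.inj hT
  have hAN : #(G.attach p x) ≤ #(G.attach p x ∪ G.attach p y) := card_le_card subset_union_left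
  have hBN : #(G.attach p y) ≤ #(G.attach p x ∪ G.attach p y) := card_le_card subset_union_right
  obtain ⟨hle, heq⟩ := detour_count hqpos hδt hQ hx hy hAN hTc
  refine ⟨by omega, fun hodd => ?_⟩
  by_contra hcon
  obtain ⟨hNq, hq⟩ := heq (by omega)
  -- Equality leaves no room for a non-adjacent pair outside `T`.
  have hmem : ∀ e : ZMod m × ZMod m, e.1 ≠ e.2 → ¬ G.Adj (p e.1) (p e.2) → e ∈ T := by
    intro e he1 he2
    by_contra heT
    have := card_adjPairs_image (G := G) (T := insert e T) H.inj (by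
      intro f hf
      rcases mem_insert.1 hf with rfl | hf
      · exact ⟨he1, he2⟩
      · exact hT f hf)
    rw [card_insert_of_notMem heT] at this
    omega
  have hA : G.attach p x = G.attach p x ∪ G.attach p y :=
    eq_of_subset_of_card_le subset_union_left (by omega)
  have hB : G.attach p y = G.attach p x ∪ G.attach p y :=
    eq_of_subset_of_card_le subset_union_right (by omega)
  have hAB : G.attach p x = G.attach p y := hA.trans hB.symm
  set A := G.attach p x ∪ G.attach p y with hAdef
  -- Predecessors of attached positions are pairwise non-adjacent too, so they must also occur in
  -- `T`.
  have hback : ∀ a ∈ A, ∀ b ∈ A, a ≠ b → (a - 1, b - 1) ∈ T := by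
    intro a ha b hb hab
    refine hmem _ (fun h => hab (by simpa using h)) ?_
    rw [← hA] at ha
    rw [← hB] at hb
    exact D.not_adj_sub_one hab ha hb
  rcases Nat.lt_or_ge Q.length 2 with hq1 | hq2
  · have hstep : ∀ a ∈ A, a - 2 ∈ A := by
      intro a ha
      obtain ⟨b, hb, hab⟩ := exists_mem_ne (s := A) (by omega) a
      rcases hTm _ (hback a ha b hb hab.symm) with h | h
      · obtain ⟨w, hw, hw'⟩ := mem_image.1 h.1
        dsimp only at hw'
        have : a - 2 = w := by linear_combination -hw'
        rwa [this]
      · omega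
    have hiter : ∀ k : ℕ, u - 2 * (k : ZMod m) ∈ A := by
      intro k
      induction k with
      | zero =>
        rw [Nat.cast_zero, mul_zero, sub_zero]
        exact mem_union_left _ hu
      | succ k ih =>
        convert hstep _ ih using 1
        push_cast
        ring
    obtain ⟨k, hk⟩ := hodd
    have h1 := hiter k
    have h2 : u - 2 * (k : ZMod m) = u + 1 := by
      have : ((2 * k + 1 : ℕ) : ZMod m) = 0 := by rw [← hk]; simp
      push_cast at this
      linear_combination -this
    rw [h2] at h1
    exact D.add_one_notMem (by omega) (mem_union_left _ hu) h1
  · have hN2 : #A = 2 := by omega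
    have hAuv : A = {u, v} := by
      refine (eq_of_subset_of_card_le ?_ (by rw [hN2, card_pair huv])).symm
      intro w hw
      rcases mem_insert.1 hw with rfl | hw
      · exact mem_union_left _ hu
      · rw [mem_singleton.1 hw]; exact mem_union_right _ hv
    have hvA : v ∈ A := mem_union_right _ hv
    have huA : u ∈ A := mem_union_left _ hu
    -- positions of the form `w + i` with `w ∈ {u, v}`
    have hpos : ∀ z, z ∈ A.image (· + 1) ∪ tailArc u Q.length ∪ tailArc v Q.length →
        ∃ i : ℕ, 1 ≤ i ∧ i ≤ Q.length ∧ (z = u + (i : ZMod m) ∨ z = v + (i : ZMod m)) := by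
      intro z hz
      rcases mem_union.1 hz with hz | hz
      · rcases mem_union.1 hz with hz | hz
        · obtain ⟨w, hw, rfl⟩ := mem_image.1 hz
          rw [hAuv] at hw
          refine ⟨1, le_rfl, by omega, ?_⟩
          rcases mem_insert.1 hw with rfl | hw
          · left; simp
          · rw [mem_singleton.1 hw]; right; simp
        · obtain ⟨i, h1, h2, rfl⟩ := mem_tailArc.1 hz
          exact ⟨i, by omega, h2, Or.inl rfl⟩
      · obtain ⟨i, h1, h2, rfl⟩ := mem_tailArc.1 hz
        exact ⟨i, by omega, h2, Or.inr rfl⟩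
    have hself : ∀ (z : ZMod m) (i : ℕ), 1 ≤ i → i ≤ Q.length → z - 1 ≠ z + (i : ZMod m) := by
      intro z i h1 h2 h
      have : ((i + 1 : ℕ) : ZMod m) = ((0 : ℕ) : ZMod m) := by
        push_cast; linear_combination -h
      have := zmod_cast_inj (by omega) (by omega) this
      omega
    have hmixed : ∀ (z w : ZMod m) (i : ℕ), z ∈ A → i ≤ Q.length →
        (∀ i : ℕ, 1 ≤ i → i ≤ Q.length → w + (i : ℕ) ∉ A) → z - 1 = w + (i : ZMod m) →
        i = Q.length := by
      intro z w i hz h2 hf h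
      by_contra hne
      refine hf (i + 1) (by omega) (by omega) ?_
      convert hz using 1
      push_cast
      linear_combination -h
    -- For `q ≥ 2` only `u` and `v` are attached, and `(u - 1, v - 1)` can lie among the positions
    -- of `T` only as the pair of arc ends `(v + q, u + q)`, which `T` avoids.
    have hT1 := hback u huA v hvA huv
    have hloc := hTm _ hT1
    have hloc' : (u - 1 : ZMod m) ∈ A.image (· + 1) ∪ tailArc u Q.length ∪ tailArc v Q.length ∧
        (v - 1 : ZMod m) ∈ A.image (· + 1) ∪ tailArc u Q.length ∪ tailArc v Q.length := by
      rcases hloc with h | h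
      · exact ⟨mem_union_left _ (mem_union_left _ h.1), mem_union_left _ (mem_union_left _ h.2)⟩
      · exact h.2.2
    obtain ⟨i, hi1, hi2, hi | hi⟩ := hpos _ hloc'.1
    · exact hself u i hi1 hi2 hi
    obtain ⟨j, hj1, hj2, hj | hj⟩ := hpos _ hloc'.2
    swap
    · exact hself v j hj1 hj2 hj
    have hiq := hmixed u v i huA hi2 hfv hi
    have hjq := hmixed v u j hvA hj2 hfu hj
    subst hiq hjq
    rcases hloc with h | h
    · obtain ⟨w, hw, hw'⟩ := mem_image.1 h.1
      dsimp only at hw'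
      rw [hi] at hw'
      refine hfv (Q.length - 1) (by omega) (by omega) ?_
      convert hw using 1
      rw [Nat.cast_sub (by omega), Nat.cast_one]
      linear_combination -hw'
    · exact h.2.1 (by rw [hi, hj])

/-- All neighbours of the first vertex of a longest path lie on the path, and the farthest has index
at least `δ`; the edge to it closes the cycle. -/
theorem exists_cycle_of_degree [Fintype V] [DecidableEq V] [DecidableRel G.Adj] [Nonempty V] {δ : ℕ}
    (h2 : 2 ≤ δ) (hδ : ∀ v, δ ≤ G.degree v) : ∃ l, δ + 1 ≤ l ∧ G.HasListCycle l := by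
  obtain ⟨L, x, y, hL, -, hx, -⟩ := exists_longest_pathList (G := G) (S := univ) univ_nonempty
  have hinj := List.nodup_iff_injective_get.1 hL.nodup
  have hpos := hL.length_pos
  have hsub : G.nbrsIn x univ ⊆ ((univ : Finset (Fin L.length)).filter
      (fun i => G.Adj x (L.get i))).image L.get := by
    intro w hw
    have hw := (mem_nbrsIn.1 hw).2
    obtain ⟨i, rfl⟩ := List.mem_iff_get.1 (hx w (mem_univ _) hw)
    exact mem_image_of_mem _ (by simpa using hw)
  have hx0 : L.get ⟨0, hpos⟩ = x := by
    have hh := hL.head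
    rw [List.head?_eq_getElem?, List.getElem?_eq_getElem hpos] at hh
    simpa using hh
  obtain ⟨k, hk, hδk⟩ : ∃ k : Fin L.length, G.Adj x (L.get k) ∧ δ ≤ k := by
    by_contra! hcon
    have hsub2 : (((univ : Finset (Fin L.length)).filter
        (fun i => G.Adj x (L.get i))).image Fin.val) ⊆ Ico 1 δ := by
      intro i hi
      obtain ⟨k, hk, rfl⟩ := mem_image.1 hi
      have hk := (mem_filter.1 hk).2
      rw [mem_Ico]
      refine ⟨Nat.one_le_iff_ne_zero.2 fun h0 => ?_, hcon k hk⟩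
      have : k = ⟨0, hpos⟩ := Fin.ext h0
      rw [this, hx0] at hk
      exact G.irrefl hk
    have c1 := card_le_card hsub
    have c2 := card_le_card hsub2
    rw [card_image_of_injective _ hinj, card_nbrsIn_univ] at c1
    rw [card_image_of_injective _ Fin.val_injective, Nat.card_Ico] at c2
    have := hδ x
    omega
  have hkl := k.2
  have hlen : (L.take (k + 1)).length = k + 1 := by rw [List.length_take]; omega
  have hP : G.IsPathList (L.take (k + 1)) x (L.get k) := by
    refine ⟨hL.nodup.sublist (List.take_sublist _ _), hL.chain.take _, ?_, ?_⟩
    · rw [List.head?_take, if_neg (by omega), hL.head]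
    · rw [List.getLast?_eq_getElem?, hlen, List.getElem?_take_of_lt (by omega)]
      simp
  refine ⟨_, ?_, hP.hasListCycle hk.symm (by omega)⟩
  omega

theorem HasListCycle.le_card [Fintype V] {l : ℕ} (h : G.HasListCycle l) : l ≤ Fintype.card V := by
  classical
  obtain ⟨L, x, y, hL, -, rfl, -⟩ := h
  rw [← List.toFinset_card_of_nodup hL.nodup]
  exact card_le_univ _

theorem HasListCycle.exists_longest [Fintype V] {l : ℕ} (h : G.HasListCycle l) :
    ∃ m, l ≤ m ∧ G.HasListCycle m ∧ ∀ j, G.HasListCycle j → j ≤ m := by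
  obtain ⟨m, hm, hmax⟩ := exists_greatest_nat ⟨l, h⟩ (fun k hk => hk.le_card)
  exact ⟨m, hmax l h, hm, hmax⟩

/-- Dirac's theorem. -/
theorem hasListCycle_card_of_degree [Fintype V] [DecidableEq V] [DecidableRel G.Adj]
    (hn : 3 ≤ Fintype.card V) (hδ : ∀ v, Fintype.card V ≤ 2 * G.degree v) :
    G.HasListCycle (Fintype.card V) := by
  have : Nonempty V := Fintype.card_pos_iff.1 (by omega)
  set δ := (Fintype.card V + 1) / 2 with hδdef
  have hδ' : ∀ v, δ ≤ G.degree v := fun v => by have := hδ v; omega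
  obtain ⟨l, hl, hcyc⟩ := exists_cycle_of_degree (by omega) hδ'
  obtain ⟨m, hlm, hm, hlong⟩ := hcyc.exists_longest
  rcases hm.le_card.lt_or_eq with hlt | heq
  · obtain ⟨p, hp⟩ := hm.exists_isCycleMap
    have : NeZero m := ⟨by omega⟩
    -- A longest cycle missing a vertex would have length at least `2δ ≥ n`.
    have := (hp.edges_le_of_longest hlong hlt hδ' (by omega)).1
    omega
  · rwa [← heq]

end SimpleGraph

/-! ### Bondy's argument: a missing cycle length bounds degree sums -/

namespace SimpleGraph

open Finset

variable {V : Type*} {G : SimpleGraph V} {m : ℕ} {p : ZMod m → V}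

namespace IsCycleMap

variable [NeZero m]

theorem not_adj_of_crossing (H : G.IsCycleMap p) {c : ℕ} (hcm : c < m) (hc : ¬ G.HasListCycle c)
    {i : ZMod m} {k : ℕ} (hk2 : 2 ≤ k) (hkc : k + 2 ≤ c) (h : G.Adj (p i) (p (i + (k : ℕ)))) :
    ¬ G.Adj (p (i + 1)) (p (i + (k + m + 1 - c : ℕ))) := by
  intro h'
  have := (H.isCycleSeq i).cycle_of_crossing (k := k) (j := k + m + 1 - c) (by omega) (by omega)
    (by omega) (by simpa using h) (by simpa using h')
  rw [show k + 1 + (m - (k + m + 1 - c)) = c by omega] at this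
  exact hc this

theorem not_adj_of_parallel (H : G.IsCycleMap p) {c : ℕ} (h4 : 4 ≤ c) (hc : ¬ G.HasListCycle c)
    {i : ZMod m} {k : ℕ} (hkc : c ≤ k + 1) (hkm : k < m) (h : G.Adj (p i) (p (i + (k : ℕ)))) :
    ¬ G.Adj (p (i + 1)) (p (i + (k + 3 - c : ℕ))) := by
  intro h'
  have := (H.isCycleSeq i).cycle_of_parallel (k := k) (j := k + 3 - c) (by omega) (by omega)
    (by omega) (by simpa using h) (by simpa using h')
  rw [show 2 + (k + 1 - (k + 3 - c)) = c by omega] at this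
  exact hc this

theorem _root_.SimpleGraph.mem_attach_cases (i : ZMod m) :
    (∀ z ∈ G.attach p (p i), z = i + 1 ∨ ∃ k : ℕ, 2 ≤ k ∧ k < m ∧ z = i + (k : ℕ)) ∧
    (∀ z ∈ G.attach p (p (i + 1)), z = i ∨ ∃ k : ℕ, 2 ≤ k ∧ k < m ∧ z = i + (k : ℕ)) := by
  constructor
  · intro z hz
    rw [mem_attach] at hz
    have hzi : i ≠ z := by rintro rfl; exact G.irrefl hz
    obtain ⟨k, h0, h1, rfl⟩ := zmod_exists_add hzi
    rcases Nat.lt_or_ge k 2 with h | h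
    · left
      rw [show k = 1 by omega]
      simp
    · exact Or.inr ⟨k, h, h1, rfl⟩
  · intro z hz
    rw [mem_attach] at hz
    by_cases hzi : i = z
    · exact Or.inl hzi.symm
    obtain ⟨k, h0, h1, rfl⟩ := zmod_exists_add hzi
    refine Or.inr ⟨k, ?_, h1, rfl⟩
    by_contra hlt
    rw [show k = 1 by omega] at hz
    simp at hz

/-- Two consecutive vertices of a cycle of length `m` whose vertices span no cycle of length `c`
have degree sum at most `m`, and in case of equality their neighbourhoods determine each other. -/
theorem card_attach_add_le (H : G.IsCycleMap p) {c : ℕ} (h4 : 4 ≤ c) (hcm : c < m)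
    (hc : ¬ G.HasListCycle c) (i : ZMod m) :
    #(G.attach p (p i)) + #(G.attach p (p (i + 1))) ≤ m ∧
    (#(G.attach p (p i)) + #(G.attach p (p (i + 1))) = m →
      (∀ k : ℕ, 2 ≤ k → k + 2 ≤ c → (G.Adj (p i) (p (i + (k : ℕ))) ↔
        ¬ G.Adj (p (i + 1)) (p (i + (k + m + 1 - c : ℕ))))) ∧
      (∀ k : ℕ, c ≤ k + 1 → k < m → (G.Adj (p i) (p (i + (k : ℕ))) ↔
        ¬ G.Adj (p (i + 1)) (p (i + (k + 3 - c : ℕ)))))) := by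
  classical
  set N₀ : Finset ℕ := {k ∈ Ico 2 m | G.Adj (p i) (p (i + (k : ℕ)))} with hN₀
  set N₁ : Finset ℕ := {k ∈ Ico 2 m | G.Adj (p (i + 1)) (p (i + (k : ℕ)))} with hN₁
  -- A permutation of `{2, …, m - 1}`. A chord at `i` to offset `k` forbids the chord at `i + 1` to
  -- offset `f k`, through crossing chords for small `k` and parallel chords for large `k`. The
  -- remaining unit in each degree is the cycle edge joining the two vertices.
  set f : ℕ → ℕ := fun k => if k + 2 ≤ c then k + m + 1 - c else k + 3 - c with hf
  have hfm : ∀ k ∈ Ico 2 m, f k ∈ Ico 2 m := by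
    intro k hk
    rw [mem_Ico] at hk ⊢
    dsimp only [f]
    split_ifs <;> omega
  have hfi : Set.InjOn f (Ico 2 m : Finset ℕ) := by
    intro k hk l hl hkl
    rw [mem_coe, mem_Ico] at hk hl
    dsimp only [f] at hkl
    split_ifs at hkl <;> omega
  have hsub0 : N₀ ⊆ Ico 2 m := filter_subset _ _
  have c0 : #(N₀.image f) = #N₀ := card_image_of_injOn (hfi.mono (coe_subset.2 hsub0))
  have hdisj : Disjoint (N₀.image f) N₁ := by
    rw [Finset.disjoint_left]
    intro j hj hj'
    obtain ⟨k, hk, rfl⟩ := mem_image.1 hj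
    obtain ⟨hkm, hk⟩ := mem_filter.1 hk
    have hj' := (mem_filter.1 hj').2
    rw [mem_Ico] at hkm
    dsimp only [f] at hj'
    split_ifs at hj' with h
    · exact H.not_adj_of_crossing hcm hc hkm.1 h hk hj'
    · exact H.not_adj_of_parallel h4 hc (by omega) hkm.2 hk hj'
  have hsub : N₀.image f ∪ N₁ ⊆ Ico 2 m := by
    apply union_subset _ (filter_subset _ _)
    intro j hj
    obtain ⟨k, hk, rfl⟩ := mem_image.1 hj
    exact hfm k (hsub0 hk)
  have hcard := card_le_card hsub
  rw [card_union_of_disjoint hdisj, c0, Nat.card_Ico] at hcard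
  obtain ⟨ha0, ha1⟩ := mem_attach_cases (G := G) (p := p) i
  have b0 : #(G.attach p (p i)) ≤ #N₀ + 1 := by
    calc _ ≤ #(insert (i + 1) (N₀.image fun k : ℕ => i + (k : ZMod m))) := by
          apply card_le_card
          intro z hz
          rcases ha0 z hz with rfl | ⟨k, h1, h2, rfl⟩
          · exact mem_insert_self _ _
          · exact mem_insert_of_mem (mem_image_of_mem (fun k : ℕ => i + (k : ZMod m))
              (mem_filter.2 ⟨mem_Ico.2 ⟨h1, h2⟩, mem_attach.1 hz⟩))
      _ ≤ _ := (card_insert_le _ _).trans (Nat.add_le_add_right card_image_le 1)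
  have b1 : #(G.attach p (p (i + 1))) ≤ #N₁ + 1 := by
    calc _ ≤ #(insert i (N₁.image fun k : ℕ => i + (k : ZMod m))) := by
          apply card_le_card
          intro z hz
          rcases ha1 z hz with rfl | ⟨k, h1, h2, rfl⟩
          · exact mem_insert_self _ _
          · exact mem_insert_of_mem (mem_image_of_mem (fun k : ℕ => i + (k : ZMod m))
              (mem_filter.2 ⟨mem_Ico.2 ⟨h1, h2⟩, mem_attach.1 hz⟩))
      _ ≤ _ := (card_insert_le _ _).trans (Nat.add_le_add_right card_image_le 1)
  refine ⟨by omega, fun heq => ?_⟩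
  -- Equality makes the two disjoint sets fill all offsets, so every non-chord at `i` yields a chord
  -- at `i + 1`.
  have hall : N₀.image f ∪ N₁ = Ico 2 m := by
    refine eq_of_subset_of_card_le hsub ?_
    rw [card_union_of_disjoint hdisj, c0, Nat.card_Ico]
    omega
  have hconv : ∀ k ∈ Ico 2 m, ¬ G.Adj (p i) (p (i + (k : ℕ))) →
      G.Adj (p (i + 1)) (p (i + (f k : ℕ))) := by
    intro k hk hnot
    have := hfm k hk
    rw [← hall, mem_union] at this
    rcases this with h | h
    · obtain ⟨l, hl, hlk⟩ := mem_image.1 h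
      have := hfi (hsub0 hl) hk hlk
      subst this
      exact absurd (mem_filter.1 hl).2 hnot
    · exact (mem_filter.1 h).2
  constructor
  · intro k h1 h2
    refine ⟨H.not_adj_of_crossing hcm hc h1 h2, fun h => ?_⟩
    by_contra hnot
    have := hconv k (mem_Ico.2 ⟨h1, by omega⟩) hnot
    dsimp only [f] at this
    rw [if_pos h2] at this
    exact h this
  · intro k h1 h2
    refine ⟨H.not_adj_of_parallel h4 hc h1 h2, fun h => ?_⟩
    by_contra hnot
    have := hconv k (mem_Ico.2 ⟨by omega, h2⟩) hnot
    dsimp only [f] at this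
    rw [if_neg (by omega)] at this
    exact h this

theorem card_adjPairs_eq_sum [DecidableEq V] (H : G.IsCycleMap p) :
    #(G.adjPairs (univ.image p)) = ∑ i, #(G.attach p (p i)) := by
  rw [card_adjPairs, sum_image fun i _ j _ hij => H.inj hij]
  exact sum_congr rfl fun i _ => (card_attach H.inj).symm

/-- Bondy's bound. -/
theorem two_mul_card_adjPairs_le [DecidableEq V] (H : G.IsCycleMap p) {c : ℕ} (h4 : 4 ≤ c)
    (hcm : c < m) (hc : ¬ G.HasListCycle c) : 2 * #(G.adjPairs (univ.image p)) ≤ m * m := by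
  have h1 : ∑ i, #(G.attach p (p (i + 1))) = ∑ i, #(G.attach p (p i)) :=
    Equiv.sum_comp (Equiv.addRight (1 : ZMod m)) fun i => #(G.attach p (p i))
  rw [H.card_adjPairs_eq_sum, two_mul]
  nth_rewrite 2 [← h1]
  rw [← sum_add_distrib]
  calc _ ≤ ∑ _i : ZMod m, m := sum_le_sum fun i _ => (H.card_attach_add_le h4 hcm hc i).1
    _ = m * m := by simp [ZMod.card]

/-- A Hamiltonian graph of order `2 h` with minimum degree at least `h`, where `h ≥ 4` is even, has
a cycle of length `h + 2`. -/
theorem hasListCycle_of_even (H : G.IsCycleMap p) {h : ℕ} (hm : m = 2 * h) (heven : Even h)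
    (hh : 4 ≤ h) (hdeg : ∀ i, h ≤ #(G.attach p (p i))) : G.HasListCycle (h + 2) := by
  by_contra hc
  have key := fun i => H.card_attach_add_le (c := h + 2) (by omega) (by omega) hc i
  -- Both degrees are at least `h` and `m = 2h`, so equality holds at every position.
  have keq : ∀ i, #(G.attach p (p i)) + #(G.attach p (p (i + 1))) = m := by
    intro i
    have h1 := (key i).1
    have h2 := hdeg i
    have h3 := hdeg (i + 1)
    omega
  have F1 : ∀ (i : ZMod m) (k : ℕ), 2 ≤ k → k ≤ h → (G.Adj (p i) (p (i + (k : ℕ))) ↔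
      ¬ G.Adj (p (i + 1)) (p (i + (k + h - 1 : ℕ)))) := by
    intro i k h1 h2
    have := ((key i).2 (keq i)).1 k h1 (by omega)
    rwa [show k + m + 1 - (h + 2) = k + h - 1 by omega] at this
  have F2 : ∀ (i : ZMod m) (k : ℕ), h + 1 ≤ k → k < m → (G.Adj (p i) (p (i + (k : ℕ))) ↔
      ¬ G.Adj (p (i + 1)) (p (i + (k + 1 - h : ℕ)))) := by
    intro i k h1 h2
    have := ((key i).2 (keq i)).2 k (by omega) h2
    rwa [show k + 3 - (h + 2) = k + 1 - h by omega] at this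
  have hm0 : ((2 * h : ℕ) : ZMod m) = 0 := by rw [← hm]; simp
  -- Complementing twice, both times through the possible edge from `s + e + 1` to `s + h + 1`,
  -- moves a chord at `s` by two positions.
  have step : ∀ (s : ZMod m) (e : ℕ), 1 ≤ e → e + 2 ≤ h →
      (G.Adj (p (s + (e : ℕ))) (p s) ↔ G.Adj (p (s + (e + 2 : ℕ))) (p s)) := by
    intro s e h1 h2
    have f2 := F2 (s + (e : ℕ)) (2 * h - e) (by omega) (by omega)
    have f1 := F1 (s + (e + 1 : ℕ)) (h - e) (by omega) (by omega)
    rw [add_assoc s, ← Nat.cast_add, show e + (2 * h - e) = 2 * h by omega, hm0, add_zero,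
      add_assoc s, add_assoc s, ← Nat.cast_succ, ← Nat.cast_add,
      show e + (2 * h - e + 1 - h) = h + 1 by omega, show e.succ = e + 1 from rfl] at f2
    rw [add_assoc s, ← Nat.cast_add, show e + 1 + (h - e) = h + 1 by omega,
      add_assoc s, add_assoc s, ← Nat.cast_succ, ← Nat.cast_add,
      show e + 1 + (h - e + h - 1) = 2 * h by omega, hm0, add_zero,
      show (e + 1).succ = e + 2 from rfl] at f1
    rw [f2, f1, not_not]
  have hodd : ∀ (s : ZMod m) (k : ℕ), 2 * k + 2 ≤ h → G.Adj (p (s + (2 * k + 1 : ℕ))) (p s) := by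
    intro s k
    induction k with
    | zero => intro _; simpa using (H.adj s).symm
    | succ k ih =>
      intro hk
      exact (step s (2 * k + 1) (by omega) (by omega)).1 (ih (by omega))
  obtain ⟨k, hk⟩ := heven
  -- As `h - 1` is odd, positions 1 and `h` are adjacent; but the cycle edge from 0 to `2h - 1`
  -- forbids exactly that chord.
  have h1 := hodd 1 (k - 1) (by omega)
  have h2 := (F2 0 (2 * h - 1) (by omega) (by omega)).1 (by
    have := (H.adj (-1)).symm
    rw [Nat.cast_sub (by omega), hm0]
    simpa using this)
  rw [show 2 * h - 1 + 1 - h = 1 + (2 * (k - 1) + 1) by omega] at h2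
  apply h2
  rw [zero_add, zero_add, Nat.cast_add, Nat.cast_one]
  exact h1.symm

end IsCycleMap

end SimpleGraph

/-! ### Vertex deletion and Woodall's bound -/

namespace SimpleGraph

open Finset

universe u

section Deletion

variable {V : Type*} {G : SimpleGraph V}

theorem HasListCycle.of_induce {s : Set V} {l : ℕ} (h : (G.induce s).HasListCycle l) :
    G.HasListCycle l := by
  obtain ⟨L, x, y, hL, hadj, hl, h3⟩ := h
  refine ⟨L.map Subtype.val, x, y, ⟨hL.nodup.map Subtype.val_injective, ?_, ?_, ?_⟩, hadj,
    by simpa using hl, h3⟩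
  · rw [List.isChain_map]
    exact hL.chain
  · rw [List.head?_map, hL.head]; rfl
  · rw [List.getLast?_map, hL.last]; rfl

variable [Fintype V] [DecidableRel G.Adj]

theorem two_mul_card_edgeFinset_le_mul : 2 * #G.edgeFinset ≤
    Fintype.card V * (Fintype.card V - 1) := by
  have := G.card_edgeFinset_le_card_choose_two
  rw [Nat.choose_two_right] at this
  have := Nat.div_mul_le_self (Fintype.card V * (Fintype.card V - 1)) 2
  omega

variable [DecidableEq V]

theorem card_edgeFinset_eq_induce_add_degree (v : V) :
    #G.edgeFinset = #(G.induce {v}ᶜ).edgeFinset + G.degree v := by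
  have h1 := G.card_edgeFinset_induce_compl_singleton v
  have h2 := G.card_edgeFinset_deleteIncidenceSet v
  have : G.degree v ≤ #G.edgeFinset := by
    rw [← card_incidenceFinset_eq_degree]
    exact card_le_card (G.incidenceFinset_subset v)
  omega

theorem card_compl_singleton (v : V) :
    Fintype.card ({v}ᶜ : Set V) = Fintype.card V - 1 := by
  rw [Fintype.card_compl_set]
  simp

end Deletion

/-- The measure `2a + b` drops when a vertex of degree at most `b` is deleted, and also when `(a,
b)` is traded for the weaker `(a - 1, b + 1)`. The trade yields length at least `a`, and with all
degrees above `b` a longest cycle of length exactly `a` would have too few edges around it. -/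
theorem exists_long_cycle_aux (N : ℕ) : ∀ (V : Type u) [Fintype V] [DecidableEq V]
    (G : SimpleGraph V) [DecidableRel G.Adj] (a b : ℕ), 2 * a + b ≤ N → 2 ≤ a → b + 1 ≤ a →
    Fintype.card V = a + b → a * (a - 1) + b * (b + 1) < 2 * #G.edgeFinset →
    ∃ l, a + 1 ≤ l ∧ G.HasListCycle l := by
  induction N with
  | zero => intros; omega
  | succ N ih =>
    intro V _ _ G _ a b hN ha hab hn he
    by_cases hdel : ∃ v, G.degree v ≤ b
    · obtain ⟨v, hv⟩ := hdel
      have hE := card_edgeFinset_eq_induce_add_degree (G := G) v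
      have hcard := card_compl_singleton v
      rcases Nat.eq_zero_or_pos b with rfl | hb
      · have := two_mul_card_edgeFinset_le_mul (G := G)
        rw [hn] at this
        simp at this he
        omega
      · obtain ⟨b, rfl⟩ : ∃ b', b = b' + 1 := ⟨b - 1, by omega⟩
        obtain ⟨l, hl, hc⟩ := ih _ (G.induce {v}ᶜ) a b (by omega) ha (by omega)
          (by rw [hcard, hn]; omega) (by nlinarith)
        exact ⟨l, hl, hc.of_induce⟩
    · push Not at hdel
      rcases Nat.lt_or_ge (b + 2) a with hlt | hge
      · obtain ⟨a, rfl⟩ : ∃ a', a = a' + 2 := ⟨a - 2, by omega⟩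
        have hbpos : 0 < b := by
          by_contra h0
          obtain rfl : b = 0 := by omega
          have := two_mul_card_edgeFinset_le_mul (G := G)
          rw [hn] at this
          simp at this he
          omega
        obtain ⟨l, hl, hc⟩ := ih V G (a + 1) (b + 1) (by omega) (by omega) (by omega) (by omega)
          (by
            rw [show a + 2 - 1 = a + 1 by omega] at he
            rw [show a + 1 - 1 = a by omega]
            nlinarith)
        obtain ⟨m, hlm, hm, hlong⟩ := hc.exists_longest
        rcases Nat.lt_or_ge (a + 2) m with h | h
        · exact ⟨m, h, hm⟩
        · obtain rfl : m = a + 2 := by omega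
          obtain ⟨p, hp⟩ := hm.exists_isCycleMap
          have := (hp.two_mul_card_edgeFinset_le hlong hbpos hn hdel).1
          omega
      -- Here `a ≤ b + 2`, so `n ≤ 2(b + 1)` and Dirac's theorem applies.
      · refine ⟨Fintype.card V, ?_, hasListCycle_card_of_degree ?_ fun v => ?_⟩
        · rcases Nat.eq_zero_or_pos b with rfl | hb
          · have := two_mul_card_edgeFinset_le_mul (G := G)
            rw [hn] at this
            simp at this he
            omega
          · omega
        · rcases Nat.eq_zero_or_pos b with rfl | hb
          · have := two_mul_card_edgeFinset_le_mul (G := G)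
            rw [hn] at this
            simp at this he
            omega
          · omega
        · have := hdel v
          omega

/-- Woodall's bound: a graph of order `a + b` with more than `a.choose 2 + (b + 1).choose 2` edges
has a cycle of length greater than `a`. -/
theorem exists_long_cycle {V : Type*} [Fintype V] [DecidableEq V] {G : SimpleGraph V}
    [DecidableRel G.Adj] {a b : ℕ} (ha : 2 ≤ a) (hab : b + 1 ≤ a)
    (hn : Fintype.card V = a + b) (he : a * (a - 1) + b * (b + 1) < 2 * #G.edgeFinset) :
    ∃ l, a + 1 ≤ l ∧ G.HasListCycle l :=
  exists_long_cycle_aux _ V G a b le_rfl ha hab hn he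

/-! ### Cliques, bows and extending a bow by a vertex -/

section Clique

variable {V : Type*} [DecidableEq V] {G : SimpleGraph V}

theorem exists_pathList_of_clique {K : Finset V} (hK : ∀ u ∈ K, ∀ w ∈ K, u ≠ w → G.Adj u w)
    {x y : V} (hx : x ∈ K) (hy : y ∈ K) (hxy : x ≠ y) :
    ∃ L, G.IsPathList L x y ∧ (∀ v, v ∈ L ↔ v ∈ K) ∧ L.length = #K := by
  set l := ((K.erase x).erase y).toList with hl
  have hmem : ∀ v, v ∈ x :: (l ++ [y]) ↔ v ∈ K := by
    intro v
    simp only [List.mem_cons, List.mem_append, hl, mem_toList, mem_erase, List.not_mem_nil,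
      or_false]
    constructor
    · rintro (rfl | h | rfl)
      exacts [hx, h.2.2, hy]
    · intro hv
      by_cases h1 : v = x
      · exact Or.inl h1
      · by_cases h2 : v = y
        · exact Or.inr (Or.inr h2)
        · exact Or.inr (Or.inl ⟨h2, h1, hv⟩)
  have hnd : (x :: (l ++ [y])).Nodup := by
    rw [List.nodup_cons, List.nodup_append]
    refine ⟨by simp [hl, hxy], nodup_toList _, by simp, ?_⟩
    intro a ha b hb hab
    rw [List.mem_singleton] at hb
    subst hab hb
    simp [hl] at ha
  refine ⟨x :: (l ++ [y]), ⟨hnd, ?_, rfl, ?_⟩, hmem, ?_⟩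
  · apply List.Pairwise.isChain
    exact List.Pairwise.imp_of_mem
      (fun ha hb hab => hK _ ((hmem _).1 ha) _ ((hmem _).1 hb) hab) hnd
  · rw [← List.cons_append, List.getLast?_append]
    simp
  · rw [← List.toFinset_card_of_nodup hnd]
    congr 1
    ext v
    rw [List.mem_toFinset, hmem]

/-- Join two neighbours of `v` by a path through the whole clique. -/
theorem hasListCycle_of_clique_insert {K : Finset V}
    (hK : ∀ u ∈ K, ∀ w ∈ K, u ≠ w → G.Adj u w) {v : V} (hv : v ∉ K)
    (h2 : 2 ≤ #(G.nbrsIn v K)) : G.HasListCycle (#K + 1) := by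
  obtain ⟨x, hx, y, hy, hxy⟩ := one_lt_card.1 h2
  rw [mem_nbrsIn] at hx hy
  obtain ⟨L, hL, hmem, hlen⟩ := exists_pathList_of_clique hK hx.1 hy.1 hxy
  have h1 := (IsPathList.singleton (G := G) v).append hL hx.2
    (by simpa [hmem] using hv)
  have hc : 2 ≤ #K := h2.trans (card_le_card fun w hw => (mem_nbrsIn.1 hw).1)
  have := h1.hasListCycle hy.2.symm (by simp; omega)
  convert this using 1
  simp [hlen]

end Clique

/-- The complete graphs on `X ∪ {z}` and on `Xᶜ` share the vertex `z` and make up all of `G`. -/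
structure IsBow {V : Type*} (G : SimpleGraph V) (z : V) (X : Finset V) : Prop where
  notMem : z ∉ X
  adj_iff : ∀ u w, G.Adj u w ↔ u ≠ w ∧ (u ∈ X → w ∈ X ∨ w = z) ∧ (w ∈ X → u ∈ X ∨ u = z)

namespace IsBow

variable {V : Type*} [DecidableEq V] {G : SimpleGraph V} {z : V} {X : Finset V}

theorem clique_left (h : G.IsBow z X) :
    ∀ u ∈ insert z X, ∀ w ∈ insert z X, u ≠ w → G.Adj u w := by
  intro u hu w hw huw
  rw [mem_insert] at hu hw
  exact (h.adj_iff u w).2 ⟨huw, fun _ => hw.symm, fun _ => hu.symm⟩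

variable [Fintype V]

theorem clique_right (h : G.IsBow z X) : ∀ u ∈ Xᶜ, ∀ w ∈ Xᶜ, u ≠ w → G.Adj u w := by
  intro u hu w hw huw
  rw [mem_compl] at hu hw
  exact (h.adj_iff u w).2 ⟨huw, fun h => absurd h hu, fun h => absurd h hw⟩

theorem two_mul_card_edgeFinset [DecidableRel G.Adj] (h : G.IsBow z X) {a b : ℕ}
    (hn : Fintype.card V = a + b) (hX : #X + 1 = a) :
    2 * #G.edgeFinset = a * (a - 1) + b * (b + 1) := by
  have hYc : #(Xᶜ) = b + 1 := by rw [card_compl]; omega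
  have hzY : z ∈ Xᶜ := mem_compl.2 h.notMem
  have dz : G.degree z = Fintype.card V - 1 := by
    rw [← card_nbrsIn_univ, ← card_univ, ← card_erase_of_mem (mem_univ z)]
    congr 1
    ext w
    rw [mem_nbrsIn, mem_erase, h.adj_iff]
    simp only [mem_univ, true_and, and_true]
    constructor
    · exact fun hw => hw.1.symm
    · exact fun hw => ⟨hw.symm, fun h' => absurd h' h.notMem, fun _ => Or.inr trivial⟩
  have dX : ∀ x ∈ X, G.degree x = #X := by
    intro x hx
    have : G.nbrsIn x univ = insert z (X.erase x) := by
      ext w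
      rw [mem_nbrsIn, mem_insert, mem_erase, h.adj_iff]
      simp only [mem_univ, true_and]
      constructor
      · rintro ⟨h1, h2, -⟩
        rcases h2 hx with h2 | h2
        · exact Or.inr ⟨h1.symm, h2⟩
        · exact Or.inl h2
      · rintro (rfl | ⟨h1, h2⟩)
        · exact ⟨fun h' => h.notMem (h' ▸ hx), fun _ => Or.inr rfl, fun h' => absurd h' h.notMem⟩
        · exact ⟨h1.symm, fun _ => Or.inl h2, fun _ => Or.inl hx⟩
    rw [← card_nbrsIn_univ, this, card_insert_of_notMem (by simp [h.notMem]),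
      card_erase_of_mem hx]
    have := card_pos.2 ⟨x, hx⟩
    omega
  have dY : ∀ y ∈ Xᶜ.erase z, G.degree y = b := by
    intro y hy
    rw [mem_erase] at hy
    have hyX := mem_compl.1 hy.2
    have : G.nbrsIn y univ = Xᶜ.erase y := by
      ext w
      rw [mem_nbrsIn, mem_erase, mem_compl, h.adj_iff]
      simp only [mem_univ, true_and]
      constructor
      · rintro ⟨h1, -, h3⟩
        refine ⟨h1.symm, fun hw => ?_⟩
        rcases h3 hw with h3 | h3
        · exact hyX h3
        · exact hy.1 h3
      · rintro ⟨h1, h2⟩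
        exact ⟨h1.symm, fun h' => absurd h' hyX, fun h' => absurd h' h2⟩
    rw [← card_nbrsIn_univ, this, card_erase_of_mem hy.2, hYc]
    omega
  rw [← sum_degrees_eq_twice_card_edges, ← sum_compl_add_sum X, ← add_sum_erase _ _ hzY, dz,
    sum_congr rfl dX, sum_congr rfl dY, sum_const, sum_const, card_erase_of_mem hzY, hYc, hn]
  subst hX
  simp only [smul_eq_mul, Nat.add_sub_cancel]
  rw [show #X + 1 + b - 1 = #X + b by omega]
  ring

end IsBow

section Extend

variable {V : Type*} [Fintype V] [DecidableEq V] {G : SimpleGraph V} [DecidableRel G.Adj]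

/-- If deleting `v` leaves two complete graphs sharing a vertex, then `v` extends one of them, or
there is a cycle one longer than the larger complete graph. -/
theorem IsBow.extend {v : V} {z : ({v}ᶜ : Set V)} {X : Finset ({v}ᶜ : Set V)}
    (h : (G.induce {v}ᶜ).IsBow z X) {a b : ℕ} (ha : 3 ≤ a)
    (hn : Fintype.card V = a + b) (hX : #X + 1 = a) (hdeg : G.degree v = b) :
    G.HasListCycle (a + 1) ∨ ∃ z X, G.IsBow z X ∧ #X + 1 = a := by
  obtain ⟨X', hX'⟩ : ∃ X' : Finset V, X' = X.map ⟨Subtype.val, Subtype.val_injective⟩ := ⟨_, rfl⟩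
  have cX' : #X' + 1 = a := by rw [hX', card_map, hX]
  have hvX' : v ∉ X' := by
    intro hv
    rw [hX'] at hv
    obtain ⟨w, -, hw⟩ := mem_map.1 hv
    exact w.2 hw
  have hzv : z.1 ≠ v := z.2
  have hmem : ∀ w : ({v}ᶜ : Set V), w.1 ∈ X' ↔ w ∈ X := by
    intro w
    rw [hX', mem_map]
    constructor
    · rintro ⟨w', hw', he⟩
      rwa [← Subtype.val_injective he]
    · exact fun hw => ⟨w, hw, rfl⟩
  have hzX' : z.1 ∉ X' := by rw [hmem]; exact h.notMem
  have hadj : ∀ u w, u ≠ v → w ≠ v → (G.Adj u w ↔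
      u ≠ w ∧ (u ∈ X' → w ∈ X' ∨ w = z.1) ∧ (w ∈ X' → u ∈ X' ∨ u = z.1)) := by
    intro u w hu hw
    have := h.adj_iff ⟨u, hu⟩ ⟨w, hw⟩
    rw [← hmem, ← hmem] at this
    simpa [Subtype.ext_iff] using this
  obtain ⟨K, hKdef⟩ : ∃ K, K = insert z.1 X' := ⟨_, rfl⟩
  have cK : #K = a := by rw [hKdef, card_insert_of_notMem hzX', cX']
  have hvK : v ∉ K := by
    rw [hKdef, mem_insert]
    rintro (h | h)
    exacts [hzv h.symm, hvX' h]
  have hK : ∀ u ∈ K, ∀ w ∈ K, u ≠ w → G.Adj u w := by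
    intro u hu w hw huw
    refine (hadj u w (fun h => hvK (h ▸ hu)) (fun h => hvK (h ▸ hw))).2 ?_
    rw [hKdef, mem_insert] at hu hw
    exact ⟨huw, fun _ => hw.symm, fun _ => hu.symm⟩
  rcases Nat.lt_or_ge (#(G.nbrsIn v K)) 2 with h2 | h2
  swap
  · left
    rw [← cK]
    exact hasListCycle_of_clique_insert hK hvK h2
  obtain ⟨Y, hY⟩ : ∃ Y, Y = (insert v K)ᶜ := ⟨_, rfl⟩
  -- With at most one neighbour in `K`, the `b` neighbours of `v` must be all `b - 1` vertices of
  -- `Y` and exactly one `x ∈ K`. The case `b = 0` only absorbs truncated subtraction.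
  have cY : #Y + 1 = b ∨ b = 0 := by
    rw [hY, card_compl, card_insert_of_notMem hvK, cK, hn]
    omega
  have hsplit : #(G.nbrsIn v univ) ≤ #(G.nbrsIn v K) + #(G.nbrsIn v Y) := by
    refine le_trans (card_le_card fun w hw => ?_) (card_nbrsIn_union_le v K Y)
    rw [mem_nbrsIn] at hw ⊢
    refine ⟨?_, hw.2⟩
    rw [mem_union, hY, mem_compl, mem_insert]
    by_cases hwK : w ∈ K
    · exact Or.inl hwK
    · exact Or.inr (by rintro (h | h); exacts [hw.2.ne' h, hwK h])
  have hYle : #(G.nbrsIn v Y) ≤ #Y := card_le_card fun w hw => (mem_nbrsIn.1 hw).1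
  rw [card_nbrsIn_univ, hdeg] at hsplit
  have hb : 0 < b := by
    have := card_le_univ (insert v K)
    rw [card_insert_of_notMem hvK, cK, hn] at this
    omega
  have hYall : ∀ w ∈ Y, G.Adj v w := by
    have : G.nbrsIn v Y = Y := eq_of_subset_of_card_le
      (fun w hw => (mem_nbrsIn.1 hw).1) (by omega)
    intro w hw
    rw [← this] at hw
    exact (mem_nbrsIn.1 hw).2
  obtain ⟨x, hx⟩ := card_eq_one.1 (show #(G.nbrsIn v K) = 1 by omega)
  have hxK : x ∈ K ∧ G.Adj v x := mem_nbrsIn.1 (hx ▸ mem_singleton_self x)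
  have hxuniq : ∀ w ∈ K, G.Adj v w → w = x := by
    intro w hw hvw
    have : w ∈ G.nbrsIn v K := mem_nbrsIn.2 ⟨hw, hvw⟩
    rwa [hx, mem_singleton] at this
  -- Either `v` joins the second clique at its old centre, or that clique was trivial and `v` is a
  -- pendant vertex at the new centre `x`.
  have hbow : (x = z.1 ∨ Y = ∅) → G.IsBow x (K.erase x) := by
    intro hxz
    have hKX : x = z.1 → K.erase x = X' := by
      rintro rfl
      rw [hKdef]
      exact erase_insert hzX'
    refine ⟨notMem_erase x K, fun u w => ?_⟩
    have key : ∀ w, w ≠ v → (G.Adj v w ↔ v ≠ w ∧ (v ∈ K.erase x → w ∈ K.erase x ∨ w = x) ∧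
        (w ∈ K.erase x → v ∈ K.erase x ∨ v = x)) := by
      intro w hwv
      have hvx : v ≠ x := hxK.2.ne
      simp only [mem_erase, hvK, and_false, false_imp_iff, true_and, false_or, hvx, imp_false,
        not_and, ne_eq]
      constructor
      · intro hvw
        exact ⟨hvw.ne, fun hwx hwK => hwx (hxuniq w hwK hvw)⟩
      · rintro ⟨-, hw⟩
        by_cases hwK : w ∈ K
        · have : w = x := by_contra fun hwx => hw hwx hwK
          rw [this]
          exact hxK.2
        · refine hYall w ?_
          rw [hY, mem_compl, mem_insert]
          rintro (h | h)
          exacts [hwv h, hwK h]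
    by_cases huv : u = v
    · subst huv
      by_cases hwv : w = u
      · subst hwv; simp
      · exact key w hwv
    by_cases hwv : w = v
    · subst hwv
      rw [G.adj_comm, key u huv]
      tauto
    rcases hxz with hxz | hYe
    · rw [hadj u w huv hwv, hKX hxz, hxz]
    · have hall : ∀ w, w ≠ v → w ∈ K := by
        intro w hw
        have : w ∉ Y := by rw [hYe]; exact notMem_empty w
        rw [hY, mem_compl, not_not, mem_insert] at this
        exact this.resolve_left hw
      have huK := hall u huv
      have hwK := hall w hwv
      constructor
      · intro huw
        refine ⟨huw.ne, fun _ => ?_, fun _ => ?_⟩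
        · by_cases hwx : w = x
          · exact Or.inr hwx
          · exact Or.inl (mem_erase.2 ⟨hwx, hwK⟩)
        · by_cases hux : u = x
          · exact Or.inr hux
          · exact Or.inl (mem_erase.2 ⟨hux, huK⟩)
      · exact fun hh => hK u huK w hwK hh.1
  by_cases hcase : x = z.1 ∨ Y = ∅
  · right
    exact ⟨x, K.erase x, hbow hcase, by rw [card_erase_of_mem hxK.1, cK]; omega⟩
  · left
    push Not at hcase
    obtain ⟨hxz, y, hy⟩ := hcase
    have hyK : y ∉ K ∧ y ≠ v := by
      rw [hY, mem_compl, mem_insert] at hy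
      tauto
    have hzK : z.1 ∈ K := hKdef ▸ mem_insert_self _ _
    have hpair : ({z.1, x} : Finset V) ⊆ K := by
      intro w hw
      rcases mem_insert.1 hw with rfl | hw
      · exact hzK
      · rw [mem_singleton.1 hw]; exact hxK.1
    -- The cycle runs from `v` through `y` to `z`, then inside `K` to `x` and back to `v`. Exactly
    -- `a - 1` vertices of `K` make its length `a + 1`.
    obtain ⟨K', hK1, hK2, cK'⟩ := exists_subsuperset_card_eq hpair (n := a - 1)
      (by rw [card_pair (Ne.symm hxz)]; omega) (by omega)
    obtain ⟨L, hL, hLm, hLl⟩ := exists_pathList_of_clique (K := K')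
      (fun u hu w hw => hK u (hK2 hu) w (hK2 hw)) (hK1 (mem_insert_self _ _))
      (hK1 (mem_insert_of_mem (mem_singleton_self _))) (Ne.symm hxz)
    have hyz : G.Adj y z.1 := by
      refine (hadj y z.1 hyK.2 hzv).2 ⟨fun h => hyK.1 (h ▸ hzK), fun h => ?_, fun h => ?_⟩
      · exact absurd (hKdef ▸ mem_insert_of_mem h) hyK.1
      · exact absurd h hzX'
    have h1 := (IsPathList.singleton (G := G) y).append hL hyz (by
      simp only [List.mem_singleton, forall_eq, hLm]
      exact fun h => hyK.1 (hK2 h))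
    have h2 := (IsPathList.singleton (G := G) v).append h1 (hYall y hy) (by
      simp only [List.mem_singleton, forall_eq, List.mem_append, hLm]
      rintro (h | h)
      exacts [hyK.2 h.symm, hvK (hK2 h)])
    have h3 := h2.hasListCycle hxK.2.symm (by simp; omega)
    convert h3 using 1
    simp only [List.length_append, List.length_singleton, hLl, cK']
    omega

end Extend

end SimpleGraph

/-! ### Even cycles from the number of edges -/

namespace SimpleGraph

open Finset

universe u

theorem exists_even_cycle_of_degree {V : Type*} [Fintype V] [DecidableEq V] {G : SimpleGraph V}
    [DecidableRel G.Adj] {a b : ℕ} (ha : Odd a) (ha3 : 3 ≤ a) (hb : 1 ≤ b) (hab : b + 1 ≤ a)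
    (hn : Fintype.card V = a + b) (he : a * (a - 1) + b * (b + 1) ≤ 2 * #G.edgeFinset)
    (hdeg : ∀ v, b + 1 ≤ G.degree v) : G.HasListCycle (a + 1) := by
  by_contra hc
  obtain ⟨m, p, hp, hlong, ham, hmn⟩ : ∃ m, ∃ p : ZMod m → V, G.IsCycleMap p ∧
      (∀ l, G.HasListCycle l → l ≤ m) ∧ a + 2 ≤ m ∧ m ≤ Fintype.card V := by
    obtain ⟨l, hl, hcl⟩ : ∃ l, a ≤ l ∧ G.HasListCycle l := by
      rcases Nat.lt_or_ge (b + 2) a with hlt | hge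
      · obtain ⟨a, rfl⟩ : ∃ a', a = a' + 2 := ⟨a - 2, by omega⟩
        -- Trading `(a, b)` for `(a - 1, b + 1)` lowers the threshold by `2(a - b - 2) > 0`, which
        -- supplies the strict inequality in Woodall's bound.
        refine exists_long_cycle (a := a + 1) (b := b + 1) (by omega) (by omega) (by omega) ?_
        rw [show a + 2 - 1 = a + 1 by omega] at he
        rw [show a + 1 - 1 = a by omega]
        nlinarith
      · exact ⟨_, by omega, hasListCycle_card_of_degree (by omega) fun v => by
          have := hdeg v
          omega⟩
    obtain ⟨m, hlm, hm, hlong⟩ := hcl.exists_longest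
    obtain ⟨p, hp⟩ := hm.exists_isCycleMap
    refine ⟨m, p, hp, hlong, ?_, hm.le_card⟩
    have : m ≠ a + 1 := fun h => hc (h ▸ hm)
    have : m ≠ a := by
      rintro rfl
      have : NeZero m := ⟨by omega⟩
      have := (hp.two_mul_card_edgeFinset_le hlong hb hn hdeg).2 ha
      omega
    omega
  have : NeZero m := ⟨by omega⟩
  have hB := hp.two_mul_card_adjPairs_le (c := a + 1) (by omega) (by omega) hc
  obtain ⟨r, hr⟩ : ∃ r, Fintype.card V = m + r := ⟨Fintype.card V - m, by omega⟩
  -- Bondy's bound contributes `m²/4` edges and the part off the cycle at most `rm/2`; together at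
  -- most `(m + r)²/4`.
  have h4 : 4 * #G.edgeFinset ≤ (m + r) * (m + r) := by
    rcases Nat.eq_zero_or_pos r with rfl | hrpos
    · have huniv : univ.image p = univ := by
        rw [← card_eq_iff_eq_univ, card_univ_image hp.inj, hr, add_zero]
      rw [huniv, card_adjPairs_univ] at hB
      simp only [add_zero]
      omega
    · have := (hp.edges_le_of_longest hlong (by omega) hdeg (by omega)).2
      rw [hr, Nat.add_sub_cancel_left] at this
      nlinarith
  have hmr : m + r = a + b := by omega
  rw [hmr] at h4
  rcases Nat.lt_or_ge (b + 2) a with hlt | hge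
  -- Twice the threshold term exceeds `(a + b)²` by `(a - b)(a - b - 2) > 0`.
  · obtain ⟨d, rfl⟩ : ∃ d, a = b + 3 + d := ⟨a - (b + 3), by omega⟩
    rw [show b + 3 + d - 1 = b + 2 + d by omega] at he
    nlinarith
  · have hmn : m = Fintype.card V := by
      have := (hasListCycle_card_of_degree (G := G) (by omega) fun v => by
          have := hdeg v
          omega)
      have := hlong _ this
      omega
    have huniv : univ.image p = univ := by
      rw [← card_eq_iff_eq_univ, card_univ_image hp.inj, hmn]
    have hatt : ∀ i, #(G.attach p (p i)) = G.degree (p i) := fun i => by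
      rw [card_attach hp.inj, huniv, card_nbrsIn_univ]
    -- The degree sum gives `2(b + 1) ≤ a + b`, so `a = b + 2`; then `h = b + 1` is even, and `a + 2
    -- ≤ m` gives `h ≥ 4`.
    have hsum := (hp.card_attach_add_le (c := a + 1) (by omega) (by omega) hc 0).1
    have h1 := hdeg (p 0)
    have h2 := hdeg (p (0 + 1))
    rw [hatt, hatt] at hsum
    obtain ⟨k, hk⟩ := ha
    have := hp.hasListCycle_of_even (h := b + 1) (by omega) ⟨k, by omega⟩ (by
      rcases Nat.lt_or_ge b 3 with h | h
      · exfalso; omega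
      · omega) (fun i => by rw [hatt]; exact hdeg _)
    rw [show b + 1 + 2 = a + 1 by omega] at this
    exact hc this

theorem exists_even_cycle_or_isBow (b : ℕ) : ∀ (V : Type u) [Fintype V] [DecidableEq V]
    (G : SimpleGraph V) [DecidableRel G.Adj] (a : ℕ), Odd a → 3 ≤ a → b + 1 ≤ a →
    Fintype.card V = a + b → a * (a - 1) + b * (b + 1) ≤ 2 * #G.edgeFinset →
    G.HasListCycle (a + 1) ∨ ∃ z X, G.IsBow z X ∧ #X + 1 = a := by
  induction b with
  | zero =>
    intro V _ _ G _ a _ ha _ hn he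
    right
    have htop : G = ⊤ := by
      have h1 : #(⊤ : SimpleGraph V).edgeFinset ≤ #G.edgeFinset := by
        rw [card_edgeFinset_top_eq_card_choose_two, Nat.choose_two_right, hn]
        simp only [add_zero, zero_mul] at he ⊢
        omega
      exact edgeFinset_inj.1 (eq_of_subset_of_card_le (edgeFinset_mono le_top) h1)
    obtain ⟨z⟩ : Nonempty V := Fintype.card_pos_iff.1 (by omega)
    refine ⟨z, univ.erase z, ⟨notMem_erase _ _, fun u w => ?_⟩, ?_⟩
    · rw [htop]
      simp only [top_adj, mem_erase, mem_univ, and_true]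
      tauto
    · rw [card_erase_of_mem (mem_univ z), card_univ]
      omega
  | succ b ih =>
    intro V _ _ G _ a hodd ha hab hn he
    by_cases hdel : ∃ v, G.degree v ≤ b + 1
    · obtain ⟨v, hv⟩ := hdel
      have hE := card_edgeFinset_eq_induce_add_degree (G := G) v
      have hcard := card_compl_singleton v
      rcases ih _ (G.induce {v}ᶜ) a hodd ha (by omega) (by rw [hcard, hn]; omega)
        (by nlinarith) with h | ⟨z, X, h, hX⟩
      · exact Or.inl h.of_induce
      -- A bow has exactly the threshold number of edges, so the deleted vertex had degree exactly
      -- `b + 1`.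
      · have h2 := h.two_mul_card_edgeFinset (a := a) (b := b) (by rw [hcard, hn]; omega) hX
        exact h.extend ha hn hX (le_antisymm hv (by nlinarith))
    · push Not at hdel
      exact Or.inl (exists_even_cycle_of_degree hodd ha (by omega) hab hn he hdel)

/-- The edge hypothesis says `e(G) ≥ ⌊n²/4⌋`, which survives deleting a vertex of degree at most
`n/2`. If every degree exceeds `n/2`, the graph is Hamiltonian and Bondy's degree sum is violated.
The induction bottoms out at order `2a`, where a deletion leads to the threshold with `b = a - 1`.
-/
theorem exists_even_cycle_of_two_mul_le (n : ℕ) : ∀ (V : Type u) [Fintype V] [DecidableEq V]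
    (G : SimpleGraph V) [DecidableRel G.Adj] (a : ℕ), Odd a → 3 ≤ a → 2 * a ≤ n →
    Fintype.card V = n → n * n ≤ 4 * #G.edgeFinset + 1 → G.HasListCycle (a + 1) := by
  induction n with
  | zero => intros; omega
  | succ n ih =>
    intro V _ _ G _ a hodd ha han hn he
    by_cases hdel : ∃ v, 2 * G.degree v ≤ n + 1
    · obtain ⟨v, hv⟩ := hdel
      have hE := card_edgeFinset_eq_induce_add_degree (G := G) v
      have hcard := card_compl_singleton v
      rw [hn, Nat.add_sub_cancel] at hcard
      rcases Nat.lt_or_ge n (2 * a) with hlt | hge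
      · obtain ⟨d, rfl⟩ : ∃ d, a = d + 1 := ⟨a - 1, by omega⟩
        obtain rfl : n = 2 * d + 1 := by omega
        have he' : (d + 1) * (d + 1) ≤ #G.edgeFinset := by
          have : (2 * d + 1 + 1) * (2 * d + 1 + 1) = 4 * ((d + 1) * (d + 1)) := by ring
          omega
        rcases exists_even_cycle_or_isBow d _ (G.induce {v}ᶜ) (d + 1) hodd ha (by omega)
          (by rw [hcard]; omega) (by rw [Nat.add_sub_cancel]; nlinarith) with h | ⟨z, X, h, hX⟩
        · exact h.of_induce
        · have h2 := h.two_mul_card_edgeFinset (a := d + 1) (b := d) (by rw [hcard]; omega) hX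
          rw [Nat.add_sub_cancel] at h2
          have hdeg : d + 1 ≤ G.degree v := by nlinarith
          set f : ({v}ᶜ : Set V) ↪ V := ⟨Subtype.val, Subtype.val_injective⟩
          have hclique : ∀ K : Finset ({v}ᶜ : Set V), #K = d + 1 →
              (∀ u ∈ K, ∀ w ∈ K, u ≠ w → (G.induce {v}ᶜ).Adj u w) →
              2 ≤ #(G.nbrsIn v (K.map f)) → G.HasListCycle (d + 1 + 1) := by
            intro K hK hcl h2
            rw [← hK, ← card_map f]
            refine hasListCycle_of_clique_insert ?_ ?_ h2
            · intro u hu w hw huw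
              obtain ⟨u, hu', rfl⟩ := mem_map.1 hu
              obtain ⟨w, hw', rfl⟩ := mem_map.1 hw
              exact hcl u hu' w hw' fun h => huw (h ▸ rfl)
            · intro hv
              obtain ⟨w, -, hw⟩ := mem_map.1 hv
              exact w.2 hw
          have cL : #(insert z X) = d + 1 := by rw [card_insert_of_notMem h.notMem, hX]
          have cR : #(Xᶜ) = d + 1 := by rw [card_compl, hcard]; omega
          -- Both cliques have order `a` and together they cover everything but `v`, so the at least
          -- `a ≥ 3` neighbours of `v` include two in one clique.
          by_contra hcon
          have h3 : ¬ 2 ≤ #(G.nbrsIn v ((insert z X).map f)) :=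
            fun h2 => hcon (hclique _ cL h.clique_left h2)
          have h4 : ¬ 2 ≤ #(G.nbrsIn v (Xᶜ.map f)) :=
            fun h2 => hcon (hclique _ cR h.clique_right h2)
          have h5 : #(G.nbrsIn v univ) ≤
              #(G.nbrsIn v ((insert z X).map f)) + #(G.nbrsIn v (Xᶜ.map f)) := by
            refine le_trans (card_le_card fun w hw => ?_) (card_nbrsIn_union_le _ _ _)
            have hvw := (mem_nbrsIn.1 hw).2
            refine mem_nbrsIn.2 ⟨?_, hvw⟩
            rw [← map_union]
            refine mem_map.2 ⟨⟨w, hvw.ne'⟩, ?_, rfl⟩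
            rw [mem_union, mem_insert, mem_compl]
            tauto
          rw [card_nbrsIn_univ] at h5
          omega
      · refine (ih _ (G.induce {v}ᶜ) a hodd ha hge hcard ?_).of_induce
        obtain ⟨t, rfl | rfl⟩ : ∃ t, n = 2 * t ∨ n = 2 * t + 1 := ⟨n / 2, by omega⟩
        · have h1 : (2 * t + 1) * (2 * t + 1) = 4 * (t * t + t) + 1 := by ring
          have h2 : 2 * t * (2 * t) = 4 * (t * t) := by ring
          omega
        · have h1 : (2 * t + 1 + 1) * (2 * t + 1 + 1) = 4 * (t * t + 2 * t + 1) := by ring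
          have h2 : (2 * t + 1) * (2 * t + 1) = 4 * (t * t + t) + 1 := by ring
          omega
    · push Not at hdel
      have hH := hasListCycle_card_of_degree (G := G) (by omega) fun v => by
        have := hdel v
        omega
      obtain ⟨p, hp⟩ := hH.exists_isCycleMap
      have : NeZero (Fintype.card V) := ⟨by omega⟩
      by_contra hc
      have huniv : univ.image p = univ := by
        rw [← card_eq_iff_eq_univ, card_univ_image hp.inj]
      have hatt : ∀ i, #(G.attach p (p i)) = G.degree (p i) := fun i => by
        rw [card_attach hp.inj, huniv, card_nbrsIn_univ]
      have hsum := (hp.card_attach_add_le (c := a + 1) (by omega) (by omega) hc 0).1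
      have h1 := hdel (p 0)
      have h2 := hdel (p (0 + 1))
      rw [hatt, hatt] at hsum
      omega

/-- All even cycles up to length `a + 1`, from the number of edges. -/
theorem hasListCycle_or_isBow {V : Type*} [Fintype V] [DecidableEq V] {G : SimpleGraph V}
    [DecidableRel G.Adj] {a b c : ℕ} (hab : b + 1 ≤ a) (hn : Fintype.card V = a + b)
    (he : a * (a - 1) + b * (b + 1) ≤ 2 * #G.edgeFinset) (hc : Odd c) (hc3 : 3 ≤ c) (hca : c ≤ a) :
    G.HasListCycle (c + 1) ∨ ∃ z X, G.IsBow z X ∧ #X + 1 = a := by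
  obtain ⟨s, rfl⟩ : ∃ s, a = c + s := ⟨a - c, by omega⟩
  obtain ⟨c, rfl⟩ : ∃ d, c = d + 1 := ⟨c - 1, by omega⟩
  rw [show c + 1 + s - 1 = c + s by omega] at he
  rcases Nat.lt_or_ge (Fintype.card V) (2 * (c + 1)) with hlt | hge
  -- Lowering the odd parameter by `s` lowers the threshold by at least `2s²`; a bow for the smaller
  -- parameter therefore forces `s = 0`.
  · have hdiff : (c + 1 + s) * (c + s) + b * (b + 1) + s * (2 * (s + b) + 2) =
        (c + 1) * c + (b + s) * (b + s + 1) + s * (2 * (c + 1) + 2 * s) := by ring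
    have hmul := Nat.mul_le_mul_left s
      (show 2 * (s + b) + 2 ≤ 2 * (c + 1) by omega)
    have hmul' : s * (2 * (c + 1) + 2 * s) = s * (2 * (c + 1)) + 2 * (s * s) := by ring
    rcases exists_even_cycle_or_isBow (b + s) V G (c + 1) hc hc3 (by omega) (by omega)
      (by rw [Nat.add_sub_cancel]; nlinarith) with h | ⟨z, X, h, hX⟩
    · exact Or.inl h
    · right
      have := h.two_mul_card_edgeFinset (a := c + 1) (b := b + s) (by omega) hX
      rw [Nat.add_sub_cancel] at this
      have hs : s * s = 0 := by nlinarith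
      have hs : s = 0 := by simpa using hs
      subst hs
      exact ⟨z, X, h, hX⟩
  · left
    refine exists_even_cycle_of_two_mul_le _ V G (c + 1) hc hc3 hge rfl ?_
    obtain ⟨d, hd⟩ : ∃ d, c + s = b + d := ⟨c + s - b, by omega⟩
    rw [hn, show c + 1 + s = b + d + 1 by omega]
    rw [show c + 1 + s = b + d + 1 by omega, hd] at he
    nlinarith

end SimpleGraph

/-! ### The extremal graph up to isomorphism, and its blocks -/

namespace SimpleGraph

section Isomorphism

open Finset

variable {V : Type*} [DecidableEq V] {G : SimpleGraph V}

theorem IsBow.nonempty_iso [Fintype V] {z : V} {X : Finset V} (h : G.IsBow z X) {a b : ℕ} (hX : #X = a)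
    (hn : Fintype.card V = a + b + 1) :
    Nonempty (G ≃g graphJoin (completeGraph (Fin 1))
      (completeGraph (Fin a) ⊕g completeGraph (Fin b))) := by
  have hY : #((insert z X)ᶜ) = b := by
    rw [card_compl, card_insert_of_notMem h.notMem, hX]
    omega
  set e₁ := (X.equivFinOfCardEq hX).symm
  set e₂ := ((insert z X)ᶜ.equivFinOfCardEq hY).symm
  have h₁ : ∀ i, (e₁ i : V) ∈ X := fun i => (e₁ i).2
  have h₂ : ∀ i, (e₂ i : V) ∉ X ∧ (e₂ i : V) ≠ z := fun i => by
    have := (e₂ i).2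
    rw [mem_compl, mem_insert] at this
    tauto
  have h₁z : ∀ i, (e₁ i : V) ≠ z := fun i hi => h.notMem (hi ▸ h₁ i)
  have h₁₂ : ∀ i j, (e₁ i : V) ≠ e₂ j := fun i j hi => (h₂ j).1 (hi ▸ h₁ i)
  set g : Fin 1 ⊕ (Fin a ⊕ Fin b) → V :=
    Sum.elim (fun _ => z) (Sum.elim (fun i => (e₁ i : V)) (fun i => (e₂ i : V))) with hg
  have hinj : Function.Injective g := by
    rintro (i | i | i) (j | j | j) hij <;> simp only [hg, Sum.elim_inl, Sum.elim_inr] at hij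
    · rw [Subsingleton.elim i j]
    · exact absurd hij.symm (h₁z j)
    · exact absurd hij.symm (h₂ j).2
    · exact absurd hij (h₁z i)
    · rw [e₁.injective (Subtype.val_injective hij)]
    · exact absurd hij (h₁₂ i j)
    · exact absurd hij (h₂ i).2
    · exact absurd hij.symm (h₁₂ j i)
    · rw [e₂.injective (Subtype.val_injective hij)]
  have hbij : Function.Bijective g := by
    rw [Fintype.bijective_iff_injective_and_card]
    refine ⟨hinj, ?_⟩
    simp [hn]
    omega
  have hadj : ∀ {s t}, G.Adj (g s) (g t) ↔ (graphJoin (completeGraph (Fin 1))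
      (completeGraph (Fin a) ⊕g completeGraph (Fin b))).Adj s t := by
    intro s t
    rw [h.adj_iff, hinj.ne_iff]
    rcases s with i | i | i <;> rcases t with j | j | j <;>
      simp [hg, graphJoin, h.notMem, h₁, h₂, h₁z, Fin.fin_one_eq_zero]
  exact ⟨(⟨Equiv.ofBijective g hbij, hadj⟩ : _ ≃g G).symm⟩

theorem exists_isBow_of_iso {a b : ℕ} (φ : G ≃g graphJoin (completeGraph (Fin 1))
    (completeGraph (Fin a) ⊕g completeGraph (Fin b))) : ∃ z X, G.IsBow z X ∧ #X = a := by
  refine ⟨φ.symm (Sum.inl 0), univ.image fun i => φ.symm (Sum.inr (Sum.inl i)), ⟨?_, ?_⟩, ?_⟩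
  · rw [mem_image]
    rintro ⟨i, -, hi⟩
    simpa using φ.symm.injective hi
  · intro u w
    obtain ⟨s, rfl⟩ := φ.symm.surjective u
    obtain ⟨t, rfl⟩ := φ.symm.surjective w
    rw [φ.symm.map_adj_iff]
    simp only [mem_image, mem_univ, true_and, φ.symm.injective.eq_iff, φ.symm.injective.ne_iff]
    rcases s with i | i | i <;> rcases t with j | j | j <;>
      simp [graphJoin, Fin.fin_one_eq_zero]
  · rw [card_image_of_injective, card_univ, Fintype.card_fin]
    intro i j hij
    simpa using φ.symm.injective hij

end Isomorphism

section Block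

variable {V : Type*} {G : SimpleGraph V}

theorem Reachable.iff_of_adj {W : Type*} {H : SimpleGraph W} {P : W → Prop}
    (hP : ∀ u w, H.Adj u w → (P u ↔ P w)) {u w : W} (h : H.Reachable u w) : P u ↔ P w := by
  obtain ⟨p⟩ := h
  induction p with
  | nil => rfl
  | cons hadj _ ih => exact (hP _ _ hadj).trans ih

theorem not_isCutVertex_of_eq_top {W : Type*} [Finite W] {H : SimpleGraph W} (h : H = ⊤) (v : W) :
    ¬ H.IsCutVertex v := by
  unfold IsCutVertex
  rw [not_lt]
  have h1 : Subsingleton (H.induce ({v}ᶜ : Set W)).ConnectedComponent := by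
    refine ⟨fun a b => ?_⟩
    induction a using ConnectedComponent.ind with | h a => ?_
    induction b using ConnectedComponent.ind with | h b => ?_
    rw [ConnectedComponent.eq]
    by_cases hab : a = b
    · rw [hab]
    · refine Adj.reachable ?_
      subst h
      simpa [Subtype.ext_iff] using hab
  have : Nonempty H.ConnectedComponent := ⟨H.connectedComponentMk v⟩
  exact (Finite.card_le_one_iff_subsingleton.2 h1).trans Finite.card_pos

/-- Away from `z` every edge stays on one side. A connected subgraph meeting both sides would
contain `z` as a cut-vertex. -/
theorem IsBow.verts_subset [Finite V] {z : V} {X : Finset V} (h : G.IsBow z X) {H : G.Subgraph}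
    (hH : H.Connected) (hcut : ∀ v, ¬ H.coe.IsCutVertex v) :
    (∀ v ∈ H.verts, v ∈ X ∨ v = z) ∨ (∀ v ∈ H.verts, v ∉ X) := by
  by_contra! hcon
  obtain ⟨⟨y, hy, hyX, hyz⟩, x, hx, hxX⟩ := hcon
  have hstep : ∀ u w, G.Adj u w → u ≠ z → w ≠ z → (u ∈ X ↔ w ∈ X) := by
    intro u w huw hu hw
    have := (h.adj_iff u w).1 huw
    tauto
  by_cases hz : z ∈ H.verts
  · refine hcut ⟨z, hz⟩ ?_
    unfold IsCutVertex
    have h1 : Nat.card H.coe.ConnectedComponent ≤ 1 := by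
      rw [Finite.card_le_one_iff_subsingleton]
      exact hH.coe.preconnected.subsingleton_connectedComponent
    refine h1.trans_lt (Finite.one_lt_card_iff_nontrivial.2 ?_)
    have hxz : x ≠ z := fun hxz => h.notMem (hxz ▸ hxX)
    refine ⟨connectedComponentMk _ ⟨⟨x, hx⟩, ?_⟩, connectedComponentMk _ ⟨⟨y, hy⟩, ?_⟩, ?_⟩
    · simpa [Subtype.ext_iff] using hxz
    · simpa [Subtype.ext_iff] using hyz
    · rw [Ne, ConnectedComponent.eq]
      intro hr
      have := hr.iff_of_adj (P := fun w => (w.1.1 : V) ∈ X) (by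
        rintro ⟨⟨u, hu⟩, hu'⟩ ⟨⟨w, hw⟩, hw'⟩ huw
        refine hstep u w (H.adj_sub huw) ?_ ?_
        · simpa [Subtype.ext_iff] using hu'
        · simpa [Subtype.ext_iff] using hw')
      exact hyX (this.1 hxX)
  · have := (hH.coe.preconnected ⟨x, hx⟩ ⟨y, hy⟩).iff_of_adj (P := fun w => (w.1 : V) ∈ X) (by
      rintro ⟨u, hu⟩ ⟨w, hw⟩ huw
      exact hstep u w (H.adj_sub huw) (fun h => hz (h ▸ hu)) (fun h => hz (h ▸ hw)))
    exact hyX (this.1 hxX)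

/-- The clique is itself connected without a cut-vertex, so a block inside it equals it by
maximality. -/
theorem IsBlock.nonempty_iso_of_subset_clique [Finite V] {B : G.Subgraph} (hB : G.IsBlock B)
    {K : Finset V} (hK : ∀ u ∈ K, ∀ w ∈ K, u ≠ w → G.Adj u w) (hne : K.Nonempty)
    (hsub : ∀ v ∈ B.verts, v ∈ K) :
    Nonempty (B.coe ≃g completeGraph (Fin K.card)) := by
  set T := (⊤ : G.Subgraph).induce (K : Set V) with hT
  have htop : T.coe = ⊤ := by
    ext ⟨u, hu⟩ ⟨w, hw⟩
    simp only [hT, Subgraph.induce_verts] at hu hw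
    simp only [Subgraph.coe_adj, hT, Subgraph.induce_adj, Subgraph.top_adj, top_adj, ne_eq,
      Subtype.mk.injEq]
    exact ⟨fun h => h.2.2.ne, fun h => ⟨hu, hw, hK u hu w hw h⟩⟩
  have hBT : B ≤ T := by
    refine ⟨hsub, fun u w huw => ?_⟩
    rw [hT, Subgraph.induce_adj]
    exact ⟨hsub u (B.edge_vert huw), hsub w (B.edge_vert huw.symm), B.adj_sub huw⟩
  have hTc : T.Connected := by
    rw [Subgraph.connected_iff', htop]
    obtain ⟨v, hv⟩ := hne
    have : Nonempty T.verts := ⟨⟨v, hv⟩⟩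
    exact connected_top
  have hTB : B = T := le_antisymm hBT (hB.2 ⟨hTc, not_isCutVertex_of_eq_top htop⟩ hBT)
  rw [hTB, htop]
  exact ⟨Iso.completeGraph K.equivFin⟩

end Block

end SimpleGraph

/-! ### The theorem -/

open SimpleGraph in
theorem theorem1p7 {V : Type*} [Fintype V] (G : SimpleGraph V) [DecidableRel G.Adj]
    (k n : ℕ) (hn : Fintype.card V = n) (hlo : 2 * k + 2 ≤ n) (hhi : n ≤ 4 * k + 1) :
    -- the theorem
    ((2 * k + 1).choose 2 + (n - 2 * k).choose 2 ≤ G.edgeFinset.card →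
      ¬ Nonempty (G ≃g SimpleGraph.graphJoin (SimpleGraph.completeGraph (Fin 1))
          (SimpleGraph.completeGraph (Fin (2 * k)) ⊕g SimpleGraph.completeGraph (Fin (n - 2 * k - 1)))) →
      ∀ l : ℕ, Even l → 4 ≤ l → l ≤ 2 * k + 2 → G.HasCycleOfLength l) ∧
    -- its edge bound is at most the conjectured one
    (((2 * k + 1).choose 2 + (n - 2 * k).choose 2 : ℕ) : ℝ)
        ≤ (2 * (k : ℝ) + 1) * ((n : ℝ) - 1) / 2 ∧
    -- the conjecture in this range
    (¬ G.HasConsecutiveEvenCycles k →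
      (G.edgeFinset.card : ℝ) ≤ (2 * (k : ℝ) + 1) * ((n : ℝ) - 1) / 2 ∧
      ((G.edgeFinset.card : ℝ) = (2 * (k : ℝ) + 1) * ((n : ℝ) - 1) / 2 →
        ∀ B : G.Subgraph, G.IsBlock B →
          Nonempty (B.coe ≃g SimpleGraph.completeGraph (Fin (2 * k + 1))))) := by
  classical
  obtain ⟨b, hb⟩ : ∃ b, n = 2 * k + 1 + b := ⟨n - (2 * k + 1), by omega⟩
  have hf : 2 * ((2 * k + 1).choose 2 + (n - 2 * k).choose 2) =
      (2 * k + 1) * (2 * k + 1 - 1) + b * (b + 1) := by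
    rw [show n - 2 * k = b + 1 by omega, mul_add, Nat.choose_two_right, Nat.choose_two_right,
      Nat.mul_div_cancel' (Nat.even_mul_pred_self _).two_dvd,
      Nat.mul_div_cancel' (Nat.even_mul_pred_self _).two_dvd, Nat.add_sub_cancel, Nat.add_sub_cancel, mul_comm (b + 1)]
  have hfR : (((2 * k + 1).choose 2 + (n - 2 * k).choose 2 : ℕ) : ℝ) =
      ((2 * k + 1) * (2 * k) + b * (b + 1)) / 2 := by
    rw [Nat.add_sub_cancel] at hf
    have := congrArg (Nat.cast : ℕ → ℝ) hf
    push_cast at this ⊢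
    linarith
  have hnR : (n : ℝ) = 2 * k + 1 + b := by rw [hb]; push_cast; ring
  have hbk : (b : ℝ) ≤ 2 * k := by
    have : b ≤ 2 * k := by omega
    exact_mod_cast this
  have hb0 : (1 : ℝ) ≤ b := by
    have : 1 ≤ b := by omega
    exact_mod_cast this
  have hbound : (((2 * k + 1).choose 2 + (n - 2 * k).choose 2 : ℕ) : ℝ)
      ≤ (2 * (k : ℝ) + 1) * ((n : ℝ) - 1) / 2 := by
    rw [hfR, hnR]
    nlinarith
  have hmain : (2 * k + 1).choose 2 + (n - 2 * k).choose 2 ≤ G.edgeFinset.card →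
      ¬ Nonempty (G ≃g SimpleGraph.graphJoin (SimpleGraph.completeGraph (Fin 1))
          (SimpleGraph.completeGraph (Fin (2 * k)) ⊕g
            SimpleGraph.completeGraph (Fin (n - 2 * k - 1)))) →
      ∀ l : ℕ, Even l → 4 ≤ l → l ≤ 2 * k + 2 → G.HasCycleOfLength l := by
    intro he hiso l ⟨j, hj⟩ h4 hl
    rcases hasListCycle_or_isBow (G := G) (a := 2 * k + 1) (b := b) (c := l - 1) (by omega)
      (by omega) (by omega) ⟨j - 1, by omega⟩ (by omega) (by omega) with h | ⟨z, X, h, hX⟩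
    · rw [show l - 1 + 1 = l by omega] at h
      exact h.hasCycleOfLength
    · exact absurd (h.nonempty_iso (a := 2 * k) (b := n - 2 * k - 1) (by omega) (by omega)) hiso
  refine ⟨hmain, hbound, fun hcyc => ?_⟩
  -- The lengths `4, 6, …, 2k + 2` are `k` consecutive even lengths, so without them `G` is below
  -- the threshold or is the exceptional bow.
  have hcase : (G.edgeFinset.card : ℝ) < ((2 * k + 1).choose 2 + (n - 2 * k).choose 2 : ℕ) ∨
      ∃ z X, G.IsBow z X ∧ X.card = 2 * k := by
    rcases Nat.lt_or_ge G.edgeFinset.card ((2 * k + 1).choose 2 + (n - 2 * k).choose 2) with h | h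
    · left
      exact_mod_cast h
    · right
      by_cases hiso : Nonempty (G ≃g SimpleGraph.graphJoin (SimpleGraph.completeGraph (Fin 1))
          (SimpleGraph.completeGraph (Fin (2 * k)) ⊕g
            SimpleGraph.completeGraph (Fin (n - 2 * k - 1))))
      · exact exists_isBow_of_iso hiso.some
      · exact absurd ⟨2, fun i hi => hmain h hiso _ ⟨2 + i, by ring⟩ (by omega) (by omega)⟩ hcyc
  rcases hcase with hlt | ⟨z, X, hbow, hX⟩
  · exact ⟨(hlt.trans_le hbound).le, fun heq => absurd heq (hlt.trans_le hbound).ne⟩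
  · have he := hbow.two_mul_card_edgeFinset (a := 2 * k + 1) (b := b) (by omega) (by omega)
    have heq : G.edgeFinset.card = (2 * k + 1).choose 2 + (n - 2 * k).choose 2 := by omega
    rw [heq]
    refine ⟨hbound, fun h B hB => ?_⟩
    -- The two bounds differ by `b(2k - b)/2` and `b ≥ 1`, so equality makes both cliques have order
    -- `2k + 1`.
    have hbk2 : (b : ℝ) = 2 * k := by
      rw [hfR, hnR] at h
      have : (b : ℝ) * (b - 2 * k) = 0 := by linarith
      rcases mul_eq_zero.1 this with h | h <;> linarith
    have hbk2 : b = 2 * k := by exact_mod_cast hbk2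
    have cL : (insert z X).card = 2 * k + 1 := by
      rw [Finset.card_insert_of_notMem hbow.notMem, hX]
    have cR : Xᶜ.card = 2 * k + 1 := by
      rw [Finset.card_compl]
      omega
    rcases hbow.verts_subset hB.1.1 hB.1.2 with hv | hv
    · rw [← cL]
      exact hB.nonempty_iso_of_subset_clique hbow.clique_left (Finset.insert_nonempty _ _)
        fun v h => Finset.mem_insert.2 (hv v h).symm
    · rw [← cR]
      exact hB.nonempty_iso_of_subset_clique hbow.clique_right ⟨z, Finset.mem_compl.2 hbow.notMem⟩
        fun v h => Finset.mem_compl.2 (hv v h)
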